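/- Let $A\in\mathbb{R}^{n\times n}$ and $C\in\mathbb{R}^{q\times n}$ be such that $(A,C)$ is detectable, i.e. $A+GC$ is Schur stable for some $G\in\mathbb{R}^{n\times q}$, where a square matrix is called Schur stable if all its (complex) eigenvalues have modulus less than $1$. Let $Q\in\mathbb{R}^{n\times n}$ be symmetric positive definite and let $\delta>0$. Assume that one of the following two conditions holds: (a) $A$ has no eigenvalue of modulus greater than $1$, and $\delta<1$; (b) $A$ has at least one eigenvalue of modulus greater than $1$, and $\delta<\frac{1}{\prod_i|\lambda_i^u(A)|}$, where $\lambda_i^u(A)$ are the eigenvalues of $A$ of modulus greater than $1$, counted with algebraic multiplicity. Then the modified algebraic Riccati equation $$P=APA^T-(1-\delta^2)\,APC^T(CPC^T+I)^{-1}CPA^T+Q$$ has exactly one symmetric positive semidefinite solution $P\in\mathbb{R}^{n\times n}$, this solution is positive definite, and with $L=-APC^T(CPC^T+I)^{-1}$ the matrix $A+(1-\sigma)LC$ is Schur stable for every $\sigma\in\mathbb{C}$ with $|\sigma|\le\delta$. -/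

import Mathlib

/-- A real matrix regarded as a complex matrix. -/
noncomputable def toComplex {m n : ℕ} (M : Matrix (Fin m) (Fin n) ℝ) :
    Matrix (Fin m) (Fin n) ℂ :=
  M.map Complex.ofReal

/-- `μ` is an eigenvalue of the complex square matrix `M`. -/
def IsEigenvalue {n : ℕ} (M : Matrix (Fin n) (Fin n) ℂ) (μ : ℂ) : Prop :=
  Module.End.HasEigenvalue (Matrix.toLin' M) μ

/-- A complex square matrix is Schur stable if all its eigenvalues have modulus less than one. -/
def IsSchurStable {n : ℕ} (M : Matrix (Fin n) (Fin n) ℂ) : Prop :=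
  ∀ μ : ℂ, IsEigenvalue M μ → ‖μ‖ < 1

/-- `(A, C)` is detectable (in discrete time): some real output injection `A + G C` is
Schur stable. -/
def IsDetectable {n q : ℕ} (A : Matrix (Fin n) (Fin n) ℝ) (C : Matrix (Fin q) (Fin n) ℝ) :
    Prop :=
  ∃ G : Matrix (Fin n) (Fin q) ℝ, IsSchurStable (toComplex (A + G * C))

/-- The product of the moduli of the eigenvalues of `A` of modulus greater than one,
counted with algebraic multiplicity. -/
noncomputable def unstableEigenvalueProduct {n : ℕ} (A : Matrix (Fin n) (Fin n) ℝ) : ℝ :=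
  (((toComplex A).charpoly.roots.filter (fun μ : ℂ => 1 < ‖μ‖)).map (fun μ : ℂ => ‖μ‖)).prod

open scoped Matrix in
/-- `P` satisfies the modified algebraic Riccati equation
`P = A P Aᵀ - (1 - δ²) A P Cᵀ (C P Cᵀ + I)⁻¹ C P Aᵀ + Q`. -/
def SatisfiesMARE {n q : ℕ} (A : Matrix (Fin n) (Fin n) ℝ) (C : Matrix (Fin q) (Fin n) ℝ)
    (Q : Matrix (Fin n) (Fin n) ℝ) (δ : ℝ) (P : Matrix (Fin n) (Fin n) ℝ) : Prop :=
  P = A * P * Aᵀ - (1 - δ ^ 2) • (A * P * Cᵀ * (C * P * Cᵀ + 1)⁻¹ * C * P * Aᵀ) + Q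

open scoped Matrix in
/-- The gain `L = -A P Cᵀ (C P Cᵀ + I)⁻¹`. -/
noncomputable def observerGain {n q : ℕ} (A : Matrix (Fin n) (Fin n) ℝ)
    (C : Matrix (Fin q) (Fin n) ℝ) (P : Matrix (Fin n) (Fin n) ℝ) :
    Matrix (Fin n) (Fin q) ℝ :=
  -(A * P * Cᵀ * (C * P * Cᵀ + 1)⁻¹)

/-- The closed-loop complex matrix `A + (1 - σ) L C`. -/
noncomputable def closedLoop {n q : ℕ} (A : Matrix (Fin n) (Fin n) ℝ)
    (C : Matrix (Fin q) (Fin n) ℝ) (L : Matrix (Fin n) (Fin q) ℝ) (σ : ℂ) :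
    Matrix (Fin n) (Fin n) ℂ :=
  toComplex A + (1 - σ) • (toComplex L * toComplex C)

/-! ### Loewner order tools and a monotone fixed-point principle. -/

section MatrixOrderTools

open scoped Matrix ComplexOrder MatrixOrder Matrix.Norms.L2Operator

set_option linter.unusedSectionVars false

variable {ι κ : Type*} [Fintype ι] [Fintype κ] [DecidableEq ι] [DecidableEq κ]

/-! Write `F` for the right-hand side of the equation. Completing the square shows that `F P` is the
minimum over gains `K` of `δ² A P Aᴴ + (1 - δ²) (A + K C) P (A + K C)ᴴ + (1 - δ²) K Kᴴ + Q`,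
attained at `riccatiGain`. Hence `F` is monotone and `F P ≥ Q`. A contracting gain `K` with
certificate `X` makes a large multiple of `X` a supersolution, so a fixed point exists
(`HasContractingGain.exists_riccati`). A fixed point is a Lyapunov certificate for its own gain,
which gives uniqueness (`riccati_le`) and stability for all `|σ| ≤ δ` (`closedLoop_stable`).

The bound on `δ` serves to produce a contracting gain. Stable eigenvalues are split off one at a
time, which leaves a matrix with all eigenvalues of modulus at least one. After scaling by `r > 1`,
its inverse is Schur stable, and the inverse `X` of an observability Gramian solves the noise-free
Riccati equation. Then `det (C X Cᴴ + 1) = |det (r A)|²`, and since `C X Cᴴ + 1 ≥ 1`, this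
determinant bounds the matrix itself; `δ |det (r A)| < 1` is what the gain needs
(`HasContractingGain.of_antistable`).

The work is done over `ℂ`; uniqueness forces the solution for real data to be symmetric, hence real.
-/

theorem Matrix.IsHermitian.exists_le_smul_one {N : Matrix ι ι ℂ} (hN : N.IsHermitian) :
    ∃ c : ℝ, 0 < c ∧ (c • (1 : Matrix ι ι ℂ) - N).PosSemidef := by
  have h := IsSelfAdjoint.le_algebraMap_norm_self (a := N) hN
  rw [Matrix.le_iff, Algebra.algebraMap_eq_smul_one] at h
  refine ⟨‖N‖ + 1, by positivity, ?_⟩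
  have h1 : ((‖N‖ + 1) • (1 : Matrix ι ι ℂ) - N) = (‖N‖ • (1 : Matrix ι ι ℂ) - N) + 1 := by module
  rw [h1]
  exact h.add .one

theorem Matrix.PosDef.exists_smul_one_le {W : Matrix ι ι ℂ} (hW : W.PosDef) :
    ∃ r : ℝ, 0 < r ∧ (W - r • (1 : Matrix ι ι ℂ)).PosSemidef := by
  obtain ⟨c, hc, h⟩ := hW.inv.isHermitian.exists_le_smul_one
  have key : ∃ r : ℝ, 0 < r ∧ ∀ i, r ≤ hW.1.eigenvalues i := by
    rcases isEmpty_or_nonempty ι with hι | hι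
    · exact ⟨1, one_pos, fun i => (hι.false i).elim⟩
    · obtain ⟨i, hi⟩ := Finite.exists_min hW.1.eigenvalues
      exact ⟨_, hW.eigenvalues_pos i, hi⟩
  obtain ⟨r, hr, hle⟩ := key
  refine ⟨r, hr, ?_⟩
  have h := algebraMap_le_of_le_spectrum (R := ℝ) (r := r) (a := W) (by
    rw [hW.1.spectrum_real_eq_range_eigenvalues]
    rintro _ ⟨i, rfl⟩
    exact hle i) hW.1
  rwa [Matrix.le_iff, Algebra.algebraMap_eq_smul_one] at h

/-- A sufficiently large multiple of a positive definite matrix dominates any Hermitian matrix. -/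
theorem Matrix.PosDef.exists_forall_smul_sub {W N : Matrix ι ι ℂ} (hW : W.PosDef)
    (hN : N.IsHermitian) : ∃ c : ℝ, 0 < c ∧ ∀ d : ℝ, c ≤ d → (d • W - N).PosDef := by
  obtain ⟨a, ha, h1⟩ := hN.exists_le_smul_one
  obtain ⟨r, hr, h2⟩ := hW.exists_smul_one_le
  refine ⟨(a + 1) / r, by positivity, fun d hd => ?_⟩
  have hd0 : 0 ≤ d := le_trans (by positivity) hd
  rw [div_le_iff₀ hr] at hd
  have : d • W - N = (1 : Matrix ι ι ℂ) + (d • (W - r • (1 : Matrix ι ι ℂ)) +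
      (a • (1 : Matrix ι ι ℂ) - N) + (d * r - (a + 1)) • (1 : Matrix ι ι ℂ)) := by module
  rw [this]
  exact Matrix.PosDef.one.add_posSemidef (((h2.smul hd0).add h1).add
    (Matrix.PosSemidef.one.smul (sub_nonneg.2 hd)))

/-- A sufficiently small Hermitian perturbation of a positive definite matrix is positive
definite. -/
theorem Matrix.PosDef.exists_forall_sub_smul {W N : Matrix ι ι ℂ} (hW : W.PosDef)
    (hN : N.IsHermitian) : ∃ c : ℝ, 0 < c ∧ ∀ d : ℝ, 0 < d → d ≤ c → (W - d • N).PosDef := by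
  obtain ⟨c, hc, h⟩ := hW.exists_forall_smul_sub hN
  refine ⟨c⁻¹, by positivity, fun d hd hdc => ?_⟩
  have := (h d⁻¹ ((le_inv_comm₀ hd hc).1 hdc)).smul hd
  rwa [smul_sub, smul_smul, mul_inv_cancel₀ hd.ne', one_smul] at this

theorem Matrix.PosDef.fromBlocks_diagonal {W : Matrix ι ι ℂ} {D : Matrix κ κ ℂ} (hW : W.PosDef)
    (hD : D.PosDef) : (Matrix.fromBlocks W 0 0 D).PosDef := by
  refine .of_dotProduct_mulVec_pos
    (Matrix.IsHermitian.fromBlocks hW.1 (by simp) hD.1) fun x hx => ?_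
  obtain ⟨y, z, rfl⟩ : ∃ y z, x = Sum.elim y z :=
    ⟨x ∘ Sum.inl, x ∘ Sum.inr, (Sum.elim_comp_inl_inr x).symm⟩
  have hstar : star (Sum.elim y z) = Sum.elim (star y) (star z) := by
    ext i; cases i <;> rfl
  rw [Matrix.fromBlocks_mulVec, hstar]
  simp only [Sum.elim_comp_inl, Sum.elim_comp_inr, Matrix.zero_mulVec, add_zero, zero_add,
    sumElim_dotProduct_sumElim]
  by_cases hy : y = 0
  · subst hy
    have hz : z ≠ 0 := by
      rintro rfl
      exact hx (by ext i; cases i <;> rfl)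
    simpa using hD.dotProduct_mulVec_pos hz
  · exact add_pos_of_pos_of_nonneg (hW.dotProduct_mulVec_pos hy)
      (hD.posSemidef.dotProduct_mulVec_nonneg z)

theorem Matrix.PosSemidef.sub_trans {A B C : Matrix ι ι ℂ} (h1 : (A - B).PosSemidef)
    (h2 : (B - C).PosSemidef) : (A - C).PosSemidef := by
  simpa using h1.add h2

/-- A Hermitian matrix bounded below by the identity is bounded above by its determinant. -/
theorem Matrix.posSemidef_det_smul_one_sub {T : Matrix ι ι ℂ} (hT : (T - 1).PosSemidef) {d : ℝ}
    (hd : ‖T.det‖ ≤ d) : (d • (1 : Matrix ι ι ℂ) - T).PosSemidef := by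
  have hTh : T.IsHermitian := by simpa using hT.1.add Matrix.isHermitian_one
  have h1 : ∀ i, 1 ≤ hTh.eigenvalues i := by
    intro i
    have hv := hT.re_dotProduct_nonneg (hTh.eigenvectorBasis i).ofLp
    rw [Matrix.sub_mulVec, hTh.mulVec_eigenvectorBasis, Matrix.one_mulVec, dotProduct_sub,
      dotProduct_smul] at hv
    have hn : star (hTh.eigenvectorBasis i).ofLp ⬝ᵥ (hTh.eigenvectorBasis i).ofLp = (1 : ℂ) := by
      have := hTh.eigenvectorBasis.orthonormal.1 i
      have h2 := inner_self_eq_norm_sq_to_K (𝕜 := ℂ) (hTh.eigenvectorBasis i)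
      rw [this] at h2
      rw [dotProduct_comm, ← EuclideanSpace.inner_eq_star_dotProduct, h2]
      simp
    rw [hn] at hv
    simpa using hv
  -- Every eigenvalue is at least one, so each single one is at most their product.
  have hdet : ∀ i, hTh.eigenvalues i ≤ d := by
    intro i
    refine le_trans ?_ hd
    rw [hTh.det_eq_prod_eigenvalues, norm_prod]
    have h2 : ∀ j, ‖(RCLike.ofReal (hTh.eigenvalues j) : ℂ)‖ = hTh.eigenvalues j := fun j => by
      rw [RCLike.norm_ofReal, abs_of_nonneg (zero_le_one.trans (h1 j))]
    simp only [h2]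
    rw [← Finset.mul_prod_erase _ _ (Finset.mem_univ i)]
    exact le_mul_of_one_le_right (zero_le_one.trans (h1 i))
      (Finset.one_le_prod fun j _ => h1 j)
  have h := le_algebraMap_of_spectrum_le (R := ℝ) (r := d) (a := T) (by
    rw [hTh.spectrum_real_eq_range_eigenvalues]
    rintro _ ⟨i, rfl⟩
    exact hdet i) hTh
  rwa [Matrix.le_iff, Algebra.algebraMap_eq_smul_one] at h

theorem Matrix.isClosed_setOf_posSemidef : IsClosed {P : Matrix ι ι ℂ | P.PosSemidef} := by
  have := CStarAlgebra.isClosed_nonneg (A := Matrix ι ι ℂ)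
  simpa only [Matrix.nonneg_iff_posSemidef] using this

/-- A monotone continuous self-map of the cone of positive semidefinite matrices which decreases
some point has a fixed point. -/
theorem Matrix.PosSemidef.exists_fixedPoint {h : Matrix ι ι ℂ → Matrix ι ι ℂ}
    (hpos : ∀ P, P.PosSemidef → (h P).PosSemidef)
    (hmono : ∀ P P', P.PosSemidef → P'.PosSemidef → (P' - P).PosSemidef →
      (h P' - h P).PosSemidef)
    (hcont : ContinuousOn h {P | P.PosSemidef}) {Z : Matrix ι ι ℂ} (hZ : Z.PosSemidef)
    (hhZ : (Z - h Z).PosSemidef) : ∃ P, P.PosSemidef ∧ h P = P := by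
  have hcl := Matrix.isClosed_setOf_posSemidef (ι := ι)
  have hSc : IsClosed ({P : Matrix ι ι ℂ | P.PosSemidef ∧ (P - h P).PosSemidef}) :=
    (continuousOn_id.sub hcont).preimage_isClosed_of_isClosed hcl hcl
  have hSc' : IsClosed ({P : Matrix ι ι ℂ | (Z - P).PosSemidef}) :=
    hcl.preimage (continuous_const.sub continuous_id)
  have hcomp : IsCompact ({P : Matrix ι ι ℂ | P.PosSemidef ∧ (P - h P).PosSemidef} ∩
      {P | (Z - P).PosSemidef}) := by
    have : ProperSpace (Matrix ι ι ℂ) := FiniteDimensional.proper ℂ _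
    refine Metric.isCompact_of_isClosed_isBounded (hSc.inter hSc') ?_
    refine (Metric.isBounded_closedBall (x := (0 : Matrix ι ι ℂ)) (r := ‖Z‖)).subset ?_
    rintro P ⟨⟨hP, -⟩, hPZ⟩
    rw [mem_closedBall_zero_iff]
    exact CStarAlgebra.norm_le_norm_of_nonneg_of_le (Matrix.nonneg_iff_posSemidef.2 hP)
      (Matrix.le_iff.2 hPZ)
  have htr : ContinuousOn (fun P : Matrix ι ι ℂ => P.trace.re)
      ({P : Matrix ι ι ℂ | P.PosSemidef ∧ (P - h P).PosSemidef} ∩ {P | (Z - P).PosSemidef}) :=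
    (Complex.continuous_re.comp (continuous_id.matrix_trace)).continuousOn
  -- Minimize the trace over `{P ≥ 0, h P ≤ P ≤ Z}`. By monotonicity `h P` is again in this set and
  -- below `P`, so `P - h P ≥ 0` has trace zero and vanishes.
  obtain ⟨P, ⟨⟨hP, hPh⟩, hPZ⟩, hmin⟩ :=
    hcomp.exists_isMinOn ⟨Z, ⟨hZ, hhZ⟩, by simpa using Matrix.PosSemidef.zero⟩ htr
  refine ⟨P, hP, ?_⟩
  have hle : P.trace.re ≤ (h P).trace.re := hmin
    ⟨⟨hpos P hP, hmono _ _ (hpos P hP) hP hPh⟩, hPZ.sub_trans hPh⟩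
  have h0 : (P - h P).trace = 0 := by
    have h1 := hPh.trace_nonneg
    rw [Complex.le_def] at h1
    rw [Matrix.trace_sub] at h1 ⊢
    refine Complex.ext ?_ h1.2.symm
    have := h1.1
    simp only [Complex.sub_re, Complex.zero_re] at this ⊢
    linarith
  exact (sub_eq_zero.1 (hPh.trace_eq_zero_iff.1 h0)).symm

end MatrixOrderTools

/-! ### Contracting gains and removal of stable eigenvalues. -/

section ContractingGain

open scoped Matrix ComplexOrder

set_option linter.unusedSectionVars false

variable {ι κ ν : Type*} [Fintype ι] [Fintype κ] [Fintype ν] [DecidableEq ι] [DecidableEq κ]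
  [DecidableEq ν]

/-- The linear operator `X ↦ δ² A X Aᴴ + (1 - δ²) M X Mᴴ`. -/
noncomputable def mixedLyapunov (δ : ℝ) (A M X : Matrix ι ι ℂ) : Matrix ι ι ℂ :=
  δ ^ 2 • (A * X * Aᴴ) + (1 - δ ^ 2) • (M * X * Mᴴ)

/-- Some output injection `K` and some `X > 0` satisfy
`δ² A X Aᴴ + (1 - δ²) (A + K C) X (A + K C)ᴴ < X`. -/
def HasContractingGain (δ : ℝ) (A : Matrix ι ι ℂ) (C : Matrix κ ι ℂ) : Prop :=
  ∃ (K : Matrix ι κ ℂ) (X : Matrix ι ι ℂ),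
    X.PosDef ∧ (X - mixedLyapunov δ A (A + K * C) X).PosDef

/-- Every eigenvector of `A` in the kernel of `C` belongs to an eigenvalue in the open unit
disc. -/
def UnobservableModesStable (A : Matrix ι ι ℂ) (C : Matrix κ ι ℂ) : Prop :=
  ∀ (μ : ℂ) (v : ι → ℂ), v ≠ 0 → A *ᵥ v = μ • v → C *ᵥ v = 0 → ‖μ‖ < 1

/-- The product of the moduli of the eigenvalues of modulus greater than one. -/
noncomputable def unstableProduct (M : Matrix ι ι ℂ) : ℝ :=
  ((M.charpoly.roots.filter (fun μ : ℂ => 1 < ‖μ‖)).map (fun μ : ℂ => ‖μ‖)).prod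

theorem Matrix.mem_spectrum_iff_exists_mulVec {M : Matrix ι ι ℂ} {μ : ℂ} :
    μ ∈ spectrum ℂ M ↔ ∃ v, v ≠ 0 ∧ M *ᵥ v = μ • v := by
  rw [Matrix.mem_spectrum_iff_isRoot_charpoly, Polynomial.IsRoot, Matrix.eval_charpoly,
    ← Matrix.exists_mulVec_eq_zero_iff]
  simp only [Matrix.sub_mulVec, sub_eq_zero, Matrix.scalar_apply,
    ← Matrix.smul_one_eq_diagonal, Matrix.smul_mulVec, Matrix.one_mulVec]
  exact exists_congr fun v => and_congr_right fun _ => eq_comm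

theorem Matrix.spectrum_transpose (M : Matrix ι ι ℂ) : spectrum ℂ Mᵀ = spectrum ℂ M := by
  ext μ
  simp only [Matrix.mem_spectrum_iff_isRoot_charpoly, Matrix.charpoly_transpose]

theorem Matrix.mul_injective_vecMul {T : Matrix ι κ ℂ} {T' : Matrix κ ι ℂ} (h : T * T' = 1) :
    Function.Injective T.vecMul := fun v w hvw => by
  simpa [Matrix.vecMul_vecMul, h] using congrArg (· ᵥ* T') hvw

/-- The certificate is transported by congruence with `T'`. The index types may differ, so that `Fin
(n + 1)` can be traded for `Fin n ⊕ Unit`. -/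
theorem HasContractingGain.of_similar {δ : ℝ} {A : Matrix ι ι ℂ} {C : Matrix κ ι ℂ}
    {T : Matrix ν ι ℂ} {T' : Matrix ι ν ℂ} (h1 : T * T' = 1) (h2 : T' * T = 1)
    (h : HasContractingGain δ (T * A * T') (C * T')) : HasContractingGain δ A C := by
  obtain ⟨K, X, hX, hW⟩ := h
  have hinj := Matrix.mul_injective_vecMul h2
  refine ⟨T' * K, T' * X * T'ᴴ, hX.mul_mul_conjTranspose_same hinj, ?_⟩
  have key : ∀ M : Matrix ι ι ℂ, M * (T' * X * T'ᴴ) * Mᴴ =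
      T' * ((T * M * T') * X * (T * M * T')ᴴ) * T'ᴴ := fun M => by
    have e1 : T' * ((T * M * T') * X * (T * M * T')ᴴ) * T'ᴴ =
      (T' * T) * M * (T' * X * T'ᴴ) * Mᴴ * (T' * T)ᴴ := by
      simp only [Matrix.conjTranspose_mul, Matrix.mul_assoc]
    rw [e1, h2]
    simp
  have hM : T * (A + T' * K * C) * T' = T * A * T' + K * (C * T') := by
    rw [Matrix.mul_add, Matrix.add_mul]
    congr 1
    calc T * (T' * K * C) * T' = (T * T') * (K * (C * T')) := by simp only [Matrix.mul_assoc]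
      _ = _ := by rw [h1, Matrix.one_mul]
  have e : T' * X * T'ᴴ - mixedLyapunov δ A (A + T' * K * C) (T' * X * T'ᴴ) =
      T' * (X - mixedLyapunov δ (T * A * T') (T * A * T' + K * (C * T')) X) * T'ᴴ := by
    rw [mixedLyapunov, key, key, hM, mixedLyapunov]
    simp only [Matrix.mul_sub, Matrix.mul_add, Matrix.sub_mul, Matrix.add_mul, Matrix.mul_smul,
      Matrix.smul_mul]
  rw [e]
  exact hW.mul_mul_conjTranspose_same hinj

/-- A left eigenvector yields a similarity to block triangular form. -/
theorem Matrix.exists_similar_fromBlocks {n : ℕ} {A : Matrix (Fin (n + 1)) (Fin (n + 1)) ℂ} {μ : ℂ}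
    (hμ : μ ∈ spectrum ℂ A) :
    ∃ (T : Matrix (Fin n ⊕ Unit) (Fin (n + 1)) ℂ) (T' : Matrix (Fin (n + 1)) (Fin n ⊕ Unit) ℂ)
      (A₁ : Matrix (Fin n) (Fin n) ℂ) (b : Matrix (Fin n) Unit ℂ),
      T * T' = 1 ∧ T' * T = 1 ∧ T * A * T' = Matrix.fromBlocks A₁ b 0 (μ • 1) ∧
      A.charpoly = A₁.charpoly * (Polynomial.X - Polynomial.C μ) := by
  rw [← Matrix.spectrum_transpose, Matrix.mem_spectrum_iff_exists_mulVec] at hμ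
  obtain ⟨w, hw, hwA⟩ := hμ
  rw [Matrix.mulVec_transpose] at hwA
  obtain ⟨i, hi⟩ := Function.ne_iff.1 hw
  -- Placing the left eigenvector in a row `i` with `w i ≠ 0` keeps `S` invertible and turns row `i`
  -- of `S A S⁻¹` into `μ` times the unit row.
  set S : Matrix (Fin (n + 1)) (Fin (n + 1)) ℂ := (1 : Matrix _ _ ℂ).updateRow i w with hS
  have hdet : S.det = w i := by
    rw [hS, ← Matrix.cramer_transpose_apply]
    simp
  have hu : IsUnit S.det := by rw [hdet]; exact isUnit_iff_ne_zero.2 hi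
  have hrow : Pi.single i 1 ᵥ* S = w := by
    rw [Matrix.single_one_vecMul]
    exact Matrix.updateRow_self
  have hSS : S * S⁻¹ = 1 := Matrix.mul_nonsing_inv _ hu
  have hSS' : S⁻¹ * S = 1 := Matrix.nonsing_inv_mul _ hu
  let e : Fin (n + 1) ≃ Fin n ⊕ Unit := (finSuccEquiv' i).trans (Equiv.optionEquivSumPUnit _)
  have he : e.symm (Sum.inr ()) = i := by simp [e]
  have hlast : ∀ j, (S * A * S⁻¹) i j = μ * (1 : Matrix (Fin (n + 1)) (Fin (n + 1)) ℂ) i j := by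
    intro j
    have h1 : Pi.single i 1 ᵥ* (S * A * S⁻¹) = μ • Pi.single i 1 := by
      rw [← Matrix.vecMul_vecMul, ← Matrix.vecMul_vecMul, hrow, hwA, Matrix.smul_vecMul, ← hrow,
        Matrix.vecMul_vecMul, hSS, Matrix.vecMul_one]
    rw [Matrix.single_one_vecMul] at h1
    have := congrFun h1 j
    simp only [Matrix.row_apply, Pi.smul_apply, smul_eq_mul] at this
    rw [this, Matrix.one_apply, Pi.single_apply]
    simp only [eq_comm]
  let B := (S * A * S⁻¹).submatrix e.symm e.symm
  have hB : B = Matrix.fromBlocks B.toBlocks₁₁ B.toBlocks₁₂ 0 (μ • 1) := by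
    conv_lhs => rw [← Matrix.fromBlocks_toBlocks B]
    congr 1
    · ext a j
      have : e.symm (Sum.inl j) ≠ i := fun h => by
        have := congrArg e h
        rw [← he] at this
        simp at this
      simp [Matrix.toBlocks₂₁, B, he, hlast, this.symm]
    · ext a c
      simp [Matrix.toBlocks₂₂, B, he, hlast]
  refine ⟨S.submatrix e.symm id, S⁻¹.submatrix id e.symm, B.toBlocks₁₁, B.toBlocks₁₂, ?_, ?_, ?_, ?_⟩
  · rw [← Matrix.submatrix_mul _ _ _ _ _ Function.bijective_id, hSS, Matrix.submatrix_one_equiv]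
  · rw [← Matrix.submatrix_mul _ _ _ _ _ e.symm.bijective, hSS', Matrix.submatrix_id_id]
  · rw [← hB]
    ext a c
    simp [B, Matrix.mul_apply, Matrix.submatrix_apply]
  · have h1 : A.charpoly = B.charpoly := by
      have h2 : B = Matrix.reindex e e (S * A * S⁻¹) := rfl
      rw [h2, Matrix.charpoly_reindex, Matrix.charpoly_mul_comm, ← Matrix.mul_assoc, hSS',
        Matrix.one_mul]
    rw [h1, hB, Matrix.charpoly_fromBlocks_zero₂₁, Matrix.toBlocks_fromBlocks₁₁]
    congr 1
    simp [Matrix.charpoly]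

/-- Contracting gains extend along a stable one-dimensional quotient. -/
theorem HasContractingGain.fromBlocks {δ : ℝ} {A : Matrix ι ι ℂ} {b : Matrix ι Unit ℂ} {μ : ℂ}
    {C : Matrix κ (ι ⊕ Unit) ℂ} (hμ : ‖μ‖ < 1) (h : HasContractingGain δ A C.toCols₁) :
    HasContractingGain δ (Matrix.fromBlocks A b 0 (μ • 1)) C := by
  obtain ⟨K, X, hX, hW⟩ := h
  set W := X - mixedLyapunov δ A (A + K * C.toCols₁) X with hWdef
  let K' : Matrix (ι ⊕ Unit) κ ℂ := Matrix.fromRows K 0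
  set d := b + K * C.toCols₂
  have hM : Matrix.fromBlocks A b 0 (μ • 1) + K' * C =
      Matrix.fromBlocks (A + K * C.toCols₁) d 0 (μ • 1) := by
    conv_lhs => rw [← Matrix.fromCols_toCols C]
    rw [Matrix.fromRows_mul_fromCols, Matrix.fromBlocks_add]
    simp [d]
  set N := δ ^ 2 • (b * bᴴ) + (1 - δ ^ 2) • (d * dᴴ)
  set m := δ ^ 2 • (star μ • b) + (1 - δ ^ 2) • (star μ • d)
  have hN : N.IsHermitian := by
    simp [N, Matrix.IsHermitian, Matrix.conjTranspose_add]
  set s : ℝ := 1 - ‖μ‖ ^ 2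
  have hs : 0 < s := by
    have := norm_nonneg μ
    simp only [s]; nlinarith
  -- The certificate is `diag (X, β)`. Half of `W` and half of the corner `β s` supply strict
  -- positivity; the other halves must absorb the off-diagonal block `-β m`, and this is the
  -- resulting Schur complement, positive for small `β`.
  obtain ⟨β, hβ, hβW⟩ : ∃ β : ℝ, 0 < β ∧
      ((1 / 2 : ℝ) • W - β • (N + (2 / s) • (m * mᴴ))).PosDef := by
    obtain ⟨c, hc, h⟩ := (hW.smul (by norm_num : (0 : ℝ) < 1 / 2)).exists_forall_sub_smul
      (hN.add (by simp [Matrix.IsHermitian] : ((2 / s) • (m * mᴴ)).IsHermitian))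
    exact ⟨c, hc, h c hc le_rfl⟩
  have hone : (β • (1 : Matrix Unit Unit ℂ)).PosDef := Matrix.PosDef.one.smul hβ
  refine ⟨K', Matrix.fromBlocks X 0 0 (β • 1), hX.fromBlocks_diagonal hone, ?_⟩
  rw [hM]
  have hnorm : μ * star μ = ((‖μ‖ ^ 2 : ℝ) : ℂ) := by
    rw [Complex.star_def, Complex.mul_conj']; push_cast; rfl
  have key : Matrix.fromBlocks X 0 0 (β • 1) - mixedLyapunov δ (Matrix.fromBlocks A b 0 (μ • 1))
      (Matrix.fromBlocks (A + K * C.toCols₁) d 0 (μ • 1)) (Matrix.fromBlocks X 0 0 (β • 1)) =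
      Matrix.fromBlocks ((1 / 2 : ℝ) • W) 0 0 ((β * s / 2) • (1 : Matrix Unit Unit ℂ)) +
      Matrix.fromBlocks ((1 / 2 : ℝ) • W - β • N) (-(β • m)) (-(β • m))ᴴ
        ((β * s / 2) • (1 : Matrix Unit Unit ℂ)) := by
    simp only [mixedLyapunov, Matrix.fromBlocks_multiply, Matrix.fromBlocks_conjTranspose,
      Matrix.fromBlocks_smul, Matrix.fromBlocks_add, sub_eq_add_neg, Matrix.fromBlocks_neg]
    simp only [Matrix.mul_zero, Matrix.zero_mul, add_zero, zero_add, Matrix.conjTranspose_zero,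
      Matrix.conjTranspose_smul, Matrix.conjTranspose_one, Matrix.mul_smul, Matrix.smul_mul,
      Matrix.mul_one, Matrix.one_mul, Matrix.conjTranspose_neg,
      Matrix.conjTranspose_add, star_star, m]
    congr 1
    · simp only [hWdef, mixedLyapunov, N, Matrix.conjTranspose_add]
      module
    · module
    · simp only [star_trivial]
      module
    · ext i j
      simp only [Matrix.add_apply, Matrix.neg_apply, Matrix.smul_apply, Complex.real_smul, s,
        smul_eq_mul]
      have : star μ * μ = ((‖μ‖ ^ 2 : ℝ) : ℂ) := by rw [mul_comm, hnorm]
      push_cast at this ⊢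
      linear_combination (-(β : ℂ) * (1 : Matrix Unit Unit ℂ) i j) * this
  rw [key]
  have hD : ((β * s / 2) • (1 : Matrix Unit Unit ℂ)).PosDef :=
    Matrix.PosDef.one.smul (by positivity)
  refine ((hW.smul (by norm_num)).fromBlocks_diagonal hD).add_posSemidef ?_
  have hDinv : ((β * s / 2) • (1 : Matrix Unit Unit ℂ)) * ((2 / (β * s)) • 1) = 1 := by
    rw [Matrix.smul_mul, Matrix.mul_smul, Matrix.one_mul, smul_smul]
    have : β * s / 2 * (2 / (β * s)) = 1 := by field_simp
    rw [this, one_smul]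
  have : Invertible ((β * s / 2) • (1 : Matrix Unit Unit ℂ)) := hD.isUnit.invertible
  rw [Matrix.PosDef.fromBlocks₂₂ _ _ hD, Matrix.inv_eq_right_inv hDinv]
  have e : (1 / 2 : ℝ) • W - β • N -
      -(β • m) * ((2 / (β * s)) • (1 : Matrix Unit Unit ℂ)) * (-(β • m))ᴴ =
      (1 / 2 : ℝ) • W - β • (N + (2 / s) • (m * mᴴ)) := by
    have h3 : β * (2 / (β * s)) * β = β * (2 / s) := by field_simp
    simp only [Matrix.conjTranspose_neg, Matrix.conjTranspose_smul, star_trivial, Matrix.neg_mul,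
      Matrix.mul_neg, Matrix.smul_mul, Matrix.mul_smul, Matrix.mul_one, smul_smul,
      smul_add]
    rw [← h3]
    module
  rw [e]
  exact hβW.posSemidef

/-- An eigenvector of `A₁` padded by zero is an eigenvector of the block triangular matrix, because
the lower left block vanishes. -/
theorem UnobservableModesStable.of_similar_fromBlocks {A : Matrix ν ν ℂ} {C : Matrix κ ν ℂ}
    (h : UnobservableModesStable A C)
    {T : Matrix (ι ⊕ Unit) ν ℂ} {T' : Matrix ν (ι ⊕ Unit) ℂ} (h1 : T * T' = 1) (h2 : T' * T = 1)
    {A₁ : Matrix ι ι ℂ} {b : Matrix ι Unit ℂ} {D : Matrix Unit Unit ℂ}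
    (hA : T * A * T' = Matrix.fromBlocks A₁ b 0 D) :
    UnobservableModesStable A₁ (C * T').toCols₁ := by
  intro μ v hv hAv hCv
  have hA' : A * T' = T' * Matrix.fromBlocks A₁ b 0 D := by
    rw [← hA]
    simp only [← Matrix.mul_assoc, h2, Matrix.one_mul]
  refine h μ (T' *ᵥ Sum.elim v 0) ?_ ?_ ?_
  · intro h0
    have := congrArg (T *ᵥ ·) h0
    simp only [Matrix.mulVec_mulVec, h1, Matrix.one_mulVec, Matrix.mulVec_zero] at this
    exact hv (by ext i; exact congrFun this (Sum.inl i))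
  · rw [Matrix.mulVec_mulVec, hA', ← Matrix.mulVec_mulVec, Matrix.fromBlocks_mulVec,
      ← Matrix.mulVec_smul]
    congr 1
    ext i
    cases i <;> simp [hAv]
  · rw [Matrix.mulVec_mulVec]
    conv_lhs => rw [← Matrix.fromCols_toCols (C * T')]
    rw [Matrix.fromCols_mulVec]
    simp [hCv]

theorem one_le_unstableProduct (M : Matrix ι ι ℂ) : 1 ≤ unstableProduct M :=
  Multiset.one_le_prod fun x hx => by
    obtain ⟨μ, h, rfl⟩ := Multiset.mem_map.1 hx
    exact (Multiset.mem_filter.1 h).2.le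

theorem unstableProduct_eq_one {M : Matrix ι ι ℂ} (h : ∀ μ ∈ spectrum ℂ M, ‖μ‖ ≤ 1) :
    unstableProduct M = 1 := by
  rw [unstableProduct, Multiset.filter_eq_nil.2, Multiset.map_zero, Multiset.prod_zero]
  intro μ hμ
  rw [Polynomial.mem_roots M.charpoly_monic.ne_zero,
    ← Matrix.mem_spectrum_iff_isRoot_charpoly] at hμ
  exact not_lt.2 (h μ hμ)

/-- The filter drops only eigenvalues of modulus exactly one, which do not affect the product. -/
theorem unstableProduct_eq_norm_det {M : Matrix ι ι ℂ} (h : ∀ μ ∈ spectrum ℂ M, 1 ≤ ‖μ‖) :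
    unstableProduct M = ‖M.det‖ := by
  have hroots : ∀ μ ∈ M.charpoly.roots, 1 ≤ ‖μ‖ := fun μ hμ => by
    rw [Polynomial.mem_roots M.charpoly_monic.ne_zero,
      ← Matrix.mem_spectrum_iff_isRoot_charpoly] at hμ
    exact h μ hμ
  rw [unstableProduct, Matrix.det_eq_prod_roots_charpoly]
  generalize M.charpoly.roots = s at hroots
  induction s using Multiset.induction_on with
  | empty => simp
  | cons a s ih =>
    have ih := ih fun μ hμ => hroots μ (Multiset.mem_cons_of_mem hμ)
    have ha := hroots a (Multiset.mem_cons_self a s)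
    rcases ha.lt_or_eq with h1 | h1
    · rw [Multiset.filter_cons_of_pos (p := fun μ : ℂ => 1 < ‖μ‖) _ h1]
      simp [ih]
    · rw [Multiset.filter_cons_of_neg (p := fun μ : ℂ => 1 < ‖μ‖) _ (by rw [← h1]; exact lt_irrefl _), ih]
      simp [← h1]

theorem unstableProduct_eq_of_charpoly {A : Matrix ι ι ℂ} {B : Matrix κ κ ℂ} {μ : ℂ}
    (hμ : ‖μ‖ < 1) (h : A.charpoly = B.charpoly * (Polynomial.X - Polynomial.C μ)) :
    unstableProduct A = unstableProduct B := by
  have hne : B.charpoly * (Polynomial.X - Polynomial.C μ) ≠ 0 := h ▸ A.charpoly_monic.ne_zero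
  rw [unstableProduct, h, Polynomial.roots_mul hne, Polynomial.roots_X_sub_C, Multiset.filter_add,
    Multiset.filter_singleton, if_neg (not_lt.2 hμ.le)]
  simp [unstableProduct]

/-- To construct contracting gains it suffices to treat matrices without stable eigenvalues. -/
theorem hasContractingGain_of_antistable_case {q : ℕ} {δ : ℝ}
    (hbase : ∀ (n : ℕ) (A : Matrix (Fin n) (Fin n) ℂ) (C : Matrix (Fin q) (Fin n) ℂ),
      (∀ μ ∈ spectrum ℂ A, 1 ≤ ‖μ‖) → UnobservableModesStable A C →
      δ * unstableProduct A < 1 → HasContractingGain δ A C) (n : ℕ) :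
    ∀ (A : Matrix (Fin n) (Fin n) ℂ) (C : Matrix (Fin q) (Fin n) ℂ),
      UnobservableModesStable A C → δ * unstableProduct A < 1 → HasContractingGain δ A C := by
  induction n with
  | zero =>
    refine fun A C hAC hδ => hbase 0 A C (fun μ hμ => ?_) hAC hδ
    obtain ⟨v, hv, -⟩ := Matrix.mem_spectrum_iff_exists_mulVec.1 hμ
    exact (hv (Subsingleton.elim _ _)).elim
  | succ n ih =>
    intro A C hAC hδ
    by_cases hA : ∀ μ ∈ spectrum ℂ A, 1 ≤ ‖μ‖
    · exact hbase _ A C hA hAC hδ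
    push Not at hA
    obtain ⟨μ, hμ, hμ1⟩ := hA
    obtain ⟨T, T', A₁, b, h1, h2, hT, hchar⟩ := Matrix.exists_similar_fromBlocks hμ
    refine .of_similar h1 h2 ?_
    rw [hT]
    refine .fromBlocks hμ1 (ih _ _ (hAC.of_similar_fromBlocks h1 h2 hT) ?_)
    rwa [← unstableProduct_eq_of_charpoly hμ1 hchar]

end ContractingGain

/-! ### Gramians and the contracting gain without stable eigenvalues. -/

section AntistableCase

open scoped Matrix ComplexOrder

set_option linter.unusedSectionVars false

variable {ι κ : Type*} [Fintype ι] [Fintype κ] [DecidableEq ι] [DecidableEq κ]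

/-- Lyapunov's theorem, read off from the splitting induction with no outputs (`q = 0`): then `K C =
0`, and the base case is contradictory except in dimension zero. The value of `δ` is immaterial. -/
theorem Matrix.exists_posDef_sub_conj_posDef {n : ℕ} {B : Matrix (Fin n) (Fin n) ℂ}
    (hB : ∀ μ ∈ spectrum ℂ B, ‖μ‖ < 1) :
    ∃ X : Matrix (Fin n) (Fin n) ℂ, X.PosDef ∧ (X - B * X * Bᴴ).PosDef := by
  have h := hasContractingGain_of_antistable_case (q := 0) (δ := 1 / 2) (fun n A C hA hAC _ => by
    rcases isEmpty_or_nonempty (Fin n) with hn | hn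
    · exact ⟨0, 1, .one, by
        rw [Subsingleton.elim (1 - mixedLyapunov _ _ _ _) (1 : Matrix (Fin n) (Fin n) ℂ)]
        exact .one⟩
    · obtain ⟨μ, hμ⟩ := spectrum.nonempty_of_isAlgClosed_of_finiteDimensional ℂ A
      obtain ⟨v, hv, hAv⟩ := Matrix.mem_spectrum_iff_exists_mulVec.1 hμ
      exact absurd (hAC μ v hv hAv (Subsingleton.elim _ _)) (not_lt.2 (hA μ hμ))) n B 0
    (fun μ v hv hBv _ => hB μ (Matrix.mem_spectrum_iff_exists_mulVec.2 ⟨v, hv, hBv⟩))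
    (by rw [unstableProduct_eq_one fun μ hμ => (hB μ hμ).le]; norm_num)
  obtain ⟨K, X, hX, hW⟩ := h
  refine ⟨X, hX, ?_⟩
  convert hW using 2
  rw [mixedLyapunov, Matrix.mul_zero, add_zero]
  module

/-- A Schur stable matrix has an observability Gramian. -/
theorem Matrix.exists_observabilityGramian {n : ℕ} {B : Matrix (Fin n) (Fin n) ℂ}
    (hB : ∀ μ ∈ spectrum ℂ B, ‖μ‖ < 1) {H : Matrix (Fin n) (Fin n) ℂ} (hH : H.PosSemidef) :
    ∃ Y : Matrix (Fin n) (Fin n) ℂ, Y.PosSemidef ∧ Bᴴ * (Y + H) * B = Y := by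
  obtain ⟨X, hX, hW⟩ := Matrix.exists_posDef_sub_conj_posDef (B := Bᴴ) (fun μ hμ => by
    rw [← Matrix.star_eq_conjTranspose, spectrum.map_star, Set.mem_star] at hμ
    simpa using hB _ hμ)
  rw [Matrix.conjTranspose_conjTranspose] at hW
  obtain ⟨c, hc, h⟩ := hW.exists_forall_smul_sub (hH.conjTranspose_mul_mul_same B).1
  have hcont : Continuous fun Y : Matrix (Fin n) (Fin n) ℂ => Bᴴ * (Y + H) * B :=
    (continuous_const.matrix_mul (continuous_id.add continuous_const)).matrix_mul continuous_const
  have hpos : ∀ P : Matrix (Fin n) (Fin n) ℂ, P.PosSemidef → (Bᴴ * (P + H) * B).PosSemidef :=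
    fun P hP => (hP.add hH).conjTranspose_mul_mul_same B
  have hcX : (c • X).PosSemidef := hX.posSemidef.smul hc.le
  -- A large multiple of the Lyapunov certificate is a supersolution of the Gramian equation.
  refine Matrix.PosSemidef.exists_fixedPoint hpos (fun P P' _ _ hPP => ?_) hcont.continuousOn
    hcX ?_
  · convert hPP.conjTranspose_mul_mul_same B using 1
    simp only [Matrix.mul_add, Matrix.add_mul, Matrix.mul_sub, Matrix.sub_mul]
    abel
  · convert (h c le_rfl).posSemidef using 1
    simp only [Matrix.mul_add, Matrix.add_mul, Matrix.mul_smul, Matrix.smul_mul, smul_sub]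
    abel

theorem Matrix.PosSemidef.mulVec_eq_zero_of_dotProduct {M : Matrix ι ι ℂ} (hM : M.PosSemidef)
    {v : ι → ℂ} (h : star v ⬝ᵥ M *ᵥ v = 0) : M *ᵥ v = 0 :=
  (hM.dotProduct_mulVec_zero_iff v).1 h

theorem Matrix.PosSemidef.add_mulVec_eq_zero {M N : Matrix ι ι ℂ} (hM : M.PosSemidef)
    (hN : N.PosSemidef) {v : ι → ℂ} (h : (M + N) *ᵥ v = 0) : M *ᵥ v = 0 ∧ N *ᵥ v = 0 := by
  have h1 : star v ⬝ᵥ M *ᵥ v + star v ⬝ᵥ N *ᵥ v = 0 := by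
    rw [← dotProduct_add, ← Matrix.add_mulVec, h, dotProduct_zero]
  have := (add_eq_zero_iff_of_nonneg (hM.dotProduct_mulVec_nonneg v)
    (hN.dotProduct_mulVec_nonneg v)).1 h1
  exact ⟨hM.mulVec_eq_zero_of_dotProduct this.1, hN.mulVec_eq_zero_of_dotProduct this.2⟩

/-- A subspace invariant under a matrix contains an eigenvector unless it is trivial. -/
theorem Matrix.exists_eigenvector_of_invariant {B : Matrix ι ι ℂ} {V : Submodule ℂ (ι → ℂ)}
    (hV : V ≠ ⊥) (hB : ∀ v ∈ V, B *ᵥ v ∈ V) : ∃ v ∈ V, v ≠ 0 ∧ ∃ μ : ℂ, B *ᵥ v = μ • v := by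
  have : Nontrivial V := (Submodule.nontrivial_iff_ne_bot).2 hV
  obtain ⟨μ, hμ⟩ := Module.End.exists_eigenvalue
    ((Matrix.toLin' B).restrict (p := V) (q := V) fun v hv => by simpa using hB v hv)
  obtain ⟨v, hv⟩ := hμ.exists_hasEigenvector
  refine ⟨v, v.2, fun h => hv.2 (Subtype.ext h), μ, ?_⟩
  have := congrArg Subtype.val hv.apply_eq_smul
  simpa using this

/-- The observability Gramian of the inverse of `A` is positive definite. -/
theorem UnobservableModesStable.gramian_posDef {A B Y : Matrix ι ι ℂ} {C : Matrix κ ι ℂ}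
    (hAC : UnobservableModesStable A C) (hAB : A * B = 1) (hB : ∀ μ ∈ spectrum ℂ B, ‖μ‖ ≤ 1)
    (hY : Y.PosSemidef) (hfix : Bᴴ * (Y + Cᴴ * C) * B = Y) : Y.PosDef := by
  rw [hY.posDef_iff_det_ne_zero]
  intro hdet
  obtain ⟨v₀, hv₀, hYv₀⟩ := Matrix.exists_mulVec_eq_zero_iff.2 hdet
  have hCC := Matrix.posSemidef_conjTranspose_mul_self C
  -- The kernel of `Y` is `B`-invariant, so if nonzero it contains an eigenvector of `B`. This would
  -- be an unobservable eigenvector of `A` for `μ⁻¹`, of modulus at least one.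
  have hker : ∀ v, Y *ᵥ v = 0 → Y *ᵥ (B *ᵥ v) = 0 ∧ C *ᵥ (B *ᵥ v) = 0 := by
    intro v hv
    have h1 : star (B *ᵥ v) ⬝ᵥ (Y + Cᴴ * C) *ᵥ (B *ᵥ v) = 0 := by
      rw [← hfix, ← Matrix.mulVec_mulVec, ← Matrix.mulVec_mulVec] at hv
      rw [Matrix.star_mulVec, ← Matrix.dotProduct_mulVec, hv, dotProduct_zero]
    obtain ⟨h2, h3⟩ := hY.add_mulVec_eq_zero hCC ((hY.add hCC).mulVec_eq_zero_of_dotProduct h1)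
    exact ⟨h2, (Matrix.conjTranspose_mul_self_mulVec_eq_zero _ _).1 h3⟩
  obtain ⟨v, hvV, hv, μ, hμ⟩ := Matrix.exists_eigenvector_of_invariant (B := B)
    (V := LinearMap.ker (Matrix.toLin' Y))
    (fun h => hv₀ (by
      have : v₀ ∈ LinearMap.ker (Matrix.toLin' Y) := by simpa using hYv₀
      rwa [h, Submodule.mem_bot] at this))
    (fun v hv => by simpa using (hker v (by simpa using hv)).1)
  have hvμ : v = μ • A *ᵥ v := by
    rw [← Matrix.mulVec_smul, ← hμ, Matrix.mulVec_mulVec, hAB, Matrix.one_mulVec]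
  have hμ0 : μ ≠ 0 := fun h => hv (by rw [hvμ, h, zero_smul])
  have hAv : A *ᵥ v = μ⁻¹ • v := by
    conv_rhs => rw [hvμ, smul_smul, inv_mul_cancel₀ hμ0, one_smul]
  have hCv : C *ᵥ v = 0 := by
    have := (hker v (by simpa using hvV)).2
    rw [hμ, Matrix.mulVec_smul] at this
    exact (smul_eq_zero.1 this).resolve_left hμ0
  have h1 := hAC _ v hv hAv hCv
  have h2 := hB μ (Matrix.mem_spectrum_iff_exists_mulVec.2 ⟨v, hv, hμ⟩)
  rw [norm_inv] at h1
  exact absurd h1 (not_lt.2 ((one_le_inv₀ (norm_pos_iff.2 hμ0)).2 h2))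

/-- With all eigenvalues of modulus at least one, there is no unobservable eigenvector at all, and
scaling creates none. -/
theorem UnobservableModesStable.smul {A : Matrix ι ι ℂ} {C : Matrix κ ι ℂ}
    (hA : ∀ μ ∈ spectrum ℂ A, 1 ≤ ‖μ‖) (h : UnobservableModesStable A C) {r : ℂ} (hr : r ≠ 0) :
    UnobservableModesStable (r • A) C := by
  intro μ v hv hAv hCv
  have h1 : A *ᵥ v = (r⁻¹ * μ) • v := by
    rw [mul_smul, ← hAv, Matrix.smul_mulVec, smul_smul, inv_mul_cancel₀ hr, one_smul]
  exact absurd (h _ v hv h1 hCv)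
    (not_lt.2 (hA _ (Matrix.mem_spectrum_iff_exists_mulVec.2 ⟨v, hv, h1⟩)))

theorem exists_one_lt_mul_pow_lt {a : ℝ} (ha : a < 1) (n : ℕ) :
    ∃ r : ℝ, 1 < r ∧ r ^ n * a < 1 := by
  have hc : Filter.Tendsto (fun r : ℝ => r ^ n * a) (nhdsWithin 1 (Set.Ioi 1)) (nhds (1 ^ n * a)) :=
    (Continuous.tendsto (by fun_prop) 1).mono_left nhdsWithin_le_nhds
  rw [one_pow, one_mul] at hc
  obtain ⟨r, hr, hr1⟩ := ((hc.eventually (gt_mem_nhds ha)).and self_mem_nhdsWithin).exists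
  exact ⟨r, hr1, hr⟩

/-- The solution of the noise-free Riccati equation associated with a matrix whose inverse is
Schur stable, together with the bound on the innovation covariance. -/
theorem UnobservableModesStable.exists_riccati_of_antistable {n q : ℕ}
    {A B : Matrix (Fin n) (Fin n) ℂ} {C : Matrix (Fin q) (Fin n) ℂ}
    (hAC : UnobservableModesStable A C) (hAB : A * B = 1) (hB : ∀ μ ∈ spectrum ℂ B, ‖μ‖ < 1) :
    ∃ X : Matrix (Fin n) (Fin n) ℂ, X.PosDef ∧
      A * (X - X * Cᴴ * (C * X * Cᴴ + 1)⁻¹ * C * X) * Aᴴ = X ∧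
      (‖A.det‖ ^ 2 • (1 : Matrix (Fin q) (Fin q) ℂ) - (C * X * Cᴴ + 1)).PosSemidef := by
  obtain ⟨Y, hY, hfix⟩ :=
    Matrix.exists_observabilityGramian hB (Matrix.posSemidef_conjTranspose_mul_self C)
  have hYpd := hAC.gramian_posDef hAB (fun μ hμ => (hB μ hμ).le) hY hfix
  have hYdet : IsUnit Y.det := (Matrix.isUnit_iff_isUnit_det _).1 hYpd.isUnit
  set X := Y⁻¹ with hXdef
  have hX : X.PosDef := hYpd.inv
  have hXY : X * Y = 1 := Matrix.nonsing_inv_mul _ hYdet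
  have hBA : B * A = 1 := mul_eq_one_comm.1 hAB
  have hS : (C * X * Cᴴ).PosSemidef := hX.posSemidef.mul_mul_conjTranspose_same C
  have hSpd : (C * X * Cᴴ + 1).PosDef := Matrix.PosDef.posSemidef_add hS .one
  have hSdet := (Matrix.isUnit_iff_isUnit_det _).1 hSpd.isUnit
  set R := (C * X * Cᴴ + 1)⁻¹ with hR
  have hRS : R * (C * X * Cᴴ + 1) = 1 := Matrix.nonsing_inv_mul _ hSdet
  have hAYA : Aᴴ * Y * A = Y + Cᴴ * C := by
    have hBAs : Aᴴ * Bᴴ = 1 := by rw [← Matrix.conjTranspose_mul, hBA, Matrix.conjTranspose_one]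
    rw [← hfix]
    calc Aᴴ * (Bᴴ * (Y + Cᴴ * C) * B) * A = (Aᴴ * Bᴴ) * (Y + Cᴴ * C) * (B * A) := by
          simp only [Matrix.mul_assoc]
      _ = Y + Cᴴ * C := by rw [hBAs, hBA, Matrix.one_mul, Matrix.mul_one]
      _ = _ := by rw [hfix]
  refine ⟨X, hX, ?_, ?_⟩
  -- Woodbury's identity: the corrected covariance is the inverse of `Y + Cᴴ C = Aᴴ Y A`, so
  -- conjugating it by `A` gives `Y⁻¹ = X`.
  · have hD : (X - X * Cᴴ * R * C * X) * (Y + Cᴴ * C) = 1 := by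
      have e : (X - X * Cᴴ * R * C * X) * (Y + Cᴴ * C) =
          X * Y - X * Cᴴ * R * C * (X * Y) + X * Cᴴ * C -
            X * Cᴴ * (R * (C * X * Cᴴ + 1)) * C + X * Cᴴ * R * C := by
        simp only [Matrix.mul_add, Matrix.add_mul, Matrix.sub_mul, Matrix.mul_assoc,
          Matrix.mul_one]
        abel
      rw [e, hXY, hRS]
      simp
    rw [← hAYA] at hD
    set D := X - X * Cᴴ * R * C * X
    have h1 : (A * D * Aᴴ) * Y = 1 := by
      have h2 : (D * (Aᴴ * Y)) * A = 1 := by simpa only [Matrix.mul_assoc] using hD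
      have h3 := mul_eq_one_comm.1 h2
      simpa only [Matrix.mul_assoc] using h3
    calc A * D * Aᴴ = A * D * Aᴴ * (Y * X) := by rw [mul_eq_one_comm.1 hXY, Matrix.mul_one]
      _ = X := by rw [← Matrix.mul_assoc, h1, Matrix.one_mul]
  · refine Matrix.posSemidef_det_smul_one_sub (by simpa using hS) (le_of_eq ?_)
    -- Sylvester's determinant identity moves `C` across, and `X (Y + Cᴴ C) = 1 + X Cᴴ C`.
    have h1 : (C * X * Cᴴ + 1).det = X.det * (Aᴴ * Y * A).det := by
      rw [add_comm, Matrix.mul_assoc, Matrix.det_one_add_mul_comm, hAYA, ← Matrix.det_mul,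
        Matrix.mul_add, hXY, Matrix.mul_assoc]
    have h2 : X.det * Y.det = 1 := by rw [← Matrix.det_mul, hXY, Matrix.det_one]
    rw [h1, Matrix.det_mul, Matrix.det_mul, Matrix.det_conjTranspose]
    rw [show X.det * (star A.det * Y.det * A.det) = (X.det * Y.det) * (star A.det * A.det) by ring,
      h2, one_mul, norm_mul, norm_star, sq]

/-- Eigenvalues on the unit circle prevent `A⁻¹` from being Schur stable; scaling by `r > 1` cures
this, and the factor `r⁻²` it leaves in the Riccati equation yields the strict inequality. -/
theorem HasContractingGain.of_antistable {n q : ℕ} {δ : ℝ} (hδ : 0 < δ) (hδ1 : δ < 1)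
    (A : Matrix (Fin n) (Fin n) ℂ) (C : Matrix (Fin q) (Fin n) ℂ)
    (hA : ∀ μ ∈ spectrum ℂ A, 1 ≤ ‖μ‖) (hAC : UnobservableModesStable A C)
    (hδA : δ * unstableProduct A < 1) : HasContractingGain δ A C := by
  rw [unstableProduct_eq_norm_det hA] at hδA
  obtain ⟨r, hr, hrδ⟩ := exists_one_lt_mul_pow_lt hδA n
  have hr0 : 0 < r := one_pos.trans hr
  have hrc : (r : ℂ) ≠ 0 := Complex.ofReal_ne_zero.2 hr0.ne'
  have hdetA : A.det ≠ 0 := by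
    intro h
    obtain ⟨v, hv, hAv⟩ := Matrix.exists_mulVec_eq_zero_iff.2 h
    have := hA 0 (Matrix.mem_spectrum_iff_exists_mulVec.2 ⟨v, hv, by rw [hAv, zero_smul]⟩)
    simp at this
    exact absurd this (by norm_num)
  have hAA : A * A⁻¹ = 1 := Matrix.mul_nonsing_inv _ (isUnit_iff_ne_zero.2 hdetA)
  set A' := (r : ℂ) • A with hA'
  set B := (r : ℂ)⁻¹ • A⁻¹ with hBdef
  have hAB : A' * B = 1 := by
    rw [hA', hBdef, Matrix.smul_mul, Matrix.mul_smul, smul_smul, mul_inv_cancel₀ hrc, hAA, one_smul]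
  have hB : ∀ μ ∈ spectrum ℂ B, ‖μ‖ < 1 := by
    intro μ hμ
    obtain ⟨v, hv, hBv⟩ := Matrix.mem_spectrum_iff_exists_mulVec.1 hμ
    have hvA : v = (μ * r) • A *ᵥ v := by
      have : (A' * B) *ᵥ v = (μ * r) • A *ᵥ v := by
        rw [← Matrix.mulVec_mulVec, hBv, Matrix.mulVec_smul, hA', Matrix.smul_mulVec, smul_smul]
      rwa [hAB, Matrix.one_mulVec] at this
    have h0 : μ * r ≠ 0 := fun h => hv (by rw [hvA, h, zero_smul])
    have h1 := hA _ (Matrix.mem_spectrum_iff_exists_mulVec.2 ⟨v, hv, by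
      conv_rhs => rw [hvA, smul_smul, inv_mul_cancel₀ h0, one_smul]⟩)
    rw [norm_inv, one_le_inv₀ (norm_pos_iff.2 h0), norm_mul, Complex.norm_real,
      Real.norm_of_nonneg hr0.le] at h1
    by_contra h2
    push Not at h2
    nlinarith
  obtain ⟨X, hX, hric, hbound⟩ :=
    (hAC.smul hA hrc).exists_riccati_of_antistable hAB hB
  have hS : (C * X * Cᴴ).PosSemidef := hX.posSemidef.mul_mul_conjTranspose_same C
  have hSpd : (C * X * Cᴴ + 1).PosDef := Matrix.PosDef.posSemidef_add hS .one
  have hSdet := (Matrix.isUnit_iff_isUnit_det _).1 hSpd.isUnit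
  set R := (C * X * Cᴴ + 1)⁻¹ with hR
  have hRS : R * (C * X * Cᴴ + 1) = 1 := Matrix.nonsing_inv_mul _ hSdet
  have hRh : Rᴴ = R := hSpd.inv.isHermitian
  have hXh : Xᴴ = X := hX.isHermitian
  set γ := 1 - δ ^ 2 with hγ
  have hγ0 : 0 < γ := by nlinarith
  have hdet : δ ^ 2 * ‖A'.det‖ ^ 2 ≤ 1 := by
    have : ‖A'.det‖ = r ^ n * ‖A.det‖ := by
      rw [hA', Matrix.det_smul, norm_mul, norm_pow, Complex.norm_real, Real.norm_of_nonneg hr0.le,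
        Fintype.card_fin]
    rw [this, ← mul_pow]
    have h0 : 0 ≤ δ * (r ^ n * ‖A.det‖) := by positivity
    have h1 : δ * (r ^ n * ‖A.det‖) < 1 := by linarith
    nlinarith
  clear_value γ
  -- `γ R - R S R ≥ 0`, where `S = C X Cᴴ`
  have hgap : (γ • R - R * (C * X * Cᴴ) * R).PosSemidef := by
    have h1 : (γ • (C * X * Cᴴ + 1) - C * X * Cᴴ).PosSemidef := by
      have : γ • (C * X * Cᴴ + 1) - C * X * Cᴴ =
          δ ^ 2 • (‖A'.det‖ ^ 2 • (1 : Matrix (Fin q) (Fin q) ℂ) - (C * X * Cᴴ + 1)) +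
            (1 - δ ^ 2 * ‖A'.det‖ ^ 2) • (1 : Matrix (Fin q) (Fin q) ℂ) := by
        rw [hγ]; module
      rw [this]
      exact (hbound.smul (sq_nonneg δ)).add (Matrix.PosSemidef.one.smul (sub_nonneg.2 hdet))
    have h2 := h1.mul_mul_conjTranspose_same R
    rw [hRh, Matrix.mul_sub, Matrix.sub_mul, Matrix.mul_smul, hRS, Matrix.smul_mul,
      Matrix.one_mul] at h2
    exact h2
  set J := A * X * Cᴴ with hJ
  have hJh : Jᴴ = C * X * Aᴴ := by
    simp only [hJ, Matrix.conjTranspose_mul, Matrix.conjTranspose_conjTranspose, hXh,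
      Matrix.mul_assoc]
  -- The factor `γ⁻¹` cancels the weight `1 - δ²` in the cross term, leaving exactly the requirement
  -- `hgap`, which amounts to `δ² (C X Cᴴ + 1) ≤ 1`.
  refine ⟨-(γ⁻¹ • (J * R)), X, hX, ?_⟩
  have hXr : A * X * Aᴴ - J * R * Jᴴ = (r ^ 2)⁻¹ • X := by
    have h1 : (r ^ 2) • (A * X * Aᴴ - J * R * Jᴴ) = X := by
      conv_rhs => rw [← hric]
      rw [Matrix.conjTranspose_smul, Complex.star_def, Complex.conj_ofReal]
      rw [hJh]
      simp only [hJ, Matrix.mul_sub, Matrix.sub_mul, Matrix.smul_mul, Matrix.mul_smul,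
        Matrix.mul_assoc]
      simp only [← Complex.coe_smul, Complex.ofReal_pow]
      module
    rw [← h1, smul_smul, h1, inv_mul_cancel₀ (by positivity), one_smul]
  have e : X - mixedLyapunov δ A (A + -(γ⁻¹ • (J * R)) * C) X =
      (1 - (r ^ 2)⁻¹) • X + γ⁻¹ • (J * (γ • R - R * (C * X * Cᴴ) * R) * Jᴴ) := by
    have h2 : (A + -(γ⁻¹ • (J * R)) * C) * X * (A + -(γ⁻¹ • (J * R)) * C)ᴴ =
        A * X * Aᴴ - (2 * γ⁻¹) • (J * R * Jᴴ) +
          (γ⁻¹ * γ⁻¹) • (J * (R * (C * X * Cᴴ) * R) * Jᴴ) := by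
      simp only [Matrix.conjTranspose_add, Matrix.conjTranspose_mul, Matrix.conjTranspose_neg,
        Matrix.conjTranspose_smul, star_trivial, hRh, hJ, Matrix.add_mul, Matrix.mul_add,
        Matrix.conjTranspose_conjTranspose, hXh,
        Matrix.neg_mul, Matrix.mul_neg, Matrix.smul_mul, Matrix.mul_smul, Matrix.mul_assoc]
      module
    rw [mixedLyapunov, h2, ← hγ, sub_smul, one_smul, ← hXr]
    simp only [Matrix.mul_sub, Matrix.sub_mul, Matrix.smul_mul, Matrix.mul_smul]
    have h3 : γ * γ⁻¹ = 1 := mul_inv_cancel₀ hγ0.ne'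
    have h4 : δ ^ 2 = 1 - γ := by rw [hγ]; ring
    rw [h4]
    simp only [smul_add, smul_sub, smul_smul]
    rw [show γ * (2 * γ⁻¹) = 2 by linear_combination 2 * h3,
      show γ * (γ⁻¹ * γ⁻¹) = γ⁻¹ by linear_combination γ⁻¹ * h3,
      show γ⁻¹ * γ = 1 by linear_combination h3]
    module
  rw [e]
  refine (hX.smul ?_).add_posSemidef
    ((hgap.mul_mul_conjTranspose_same J).smul (inv_nonneg.2 hγ0.le))
  have : (r ^ 2)⁻¹ < 1 := inv_lt_one_of_one_lt₀ (by nlinarith)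
  linarith

theorem UnobservableModesStable.hasContractingGain {n q : ℕ} {δ : ℝ} (hδ : 0 < δ)
    {A : Matrix (Fin n) (Fin n) ℂ} {C : Matrix (Fin q) (Fin n) ℂ}
    (hAC : UnobservableModesStable A C) (hδA : δ * unstableProduct A < 1) :
    HasContractingGain δ A C := by
  have hδ1 : δ < 1 := by
    have := one_le_unstableProduct A
    nlinarith
  exact hasContractingGain_of_antistable_case
    (fun n A C hA hAC h => .of_antistable hδ hδ1 A C hA hAC h) n A C hAC hδA

end AntistableCase

/-! ### The modified Riccati map: existence, uniqueness, stability. -/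

section ModifiedRiccati

open scoped Matrix ComplexOrder

set_option linter.unusedSectionVars false

variable {ι κ : Type*} [Fintype ι] [Fintype κ] [DecidableEq ι] [DecidableEq κ]

/-- The right-hand side of the modified algebraic Riccati equation. -/
noncomputable def riccatiMap (δ : ℝ) (A : Matrix ι ι ℂ) (C : Matrix κ ι ℂ) (Q P : Matrix ι ι ℂ) :
    Matrix ι ι ℂ :=
  A * P * Aᴴ - (1 - δ ^ 2) • (A * P * Cᴴ * (C * P * Cᴴ + 1)⁻¹ * C * P * Aᴴ) + Q

/-- The observer gain attached to `P`. -/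
noncomputable def riccatiGain (A : Matrix ι ι ℂ) (C : Matrix κ ι ℂ) (P : Matrix ι ι ℂ) :
    Matrix ι κ ℂ :=
  -(A * P * Cᴴ * (C * P * Cᴴ + 1)⁻¹)

theorem Matrix.PosSemidef.innovation_posDef {P : Matrix ι ι ℂ} (hP : P.PosSemidef)
    (C : Matrix κ ι ℂ) : (C * P * Cᴴ + 1).PosDef :=
  Matrix.PosDef.posSemidef_add (hP.mul_mul_conjTranspose_same C) .one

theorem mixedLyapunov_sub (δ : ℝ) (A M X Y : Matrix ι ι ℂ) :
    mixedLyapunov δ A M (X - Y) = mixedLyapunov δ A M X - mixedLyapunov δ A M Y := by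
  simp only [mixedLyapunov, Matrix.mul_sub, Matrix.sub_mul]
  module

theorem mixedLyapunov_smul (δ c : ℝ) (A M X : Matrix ι ι ℂ) :
    mixedLyapunov δ A M (c • X) = c • mixedLyapunov δ A M X := by
  simp only [mixedLyapunov, Matrix.mul_smul, Matrix.smul_mul]
  module

theorem mixedLyapunov_posSemidef {δ : ℝ} (hδ : 0 ≤ 1 - δ ^ 2) (A M : Matrix ι ι ℂ)
    {X : Matrix ι ι ℂ} (hX : X.PosSemidef) : (mixedLyapunov δ A M X).PosSemidef :=
  ((hX.mul_mul_conjTranspose_same A).smul (sq_nonneg δ)).add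
    ((hX.mul_mul_conjTranspose_same M).smul hδ)

/-- Completion of the square: the gain minimizes the one-step error covariance. -/
theorem mixedLyapunov_add_sub_riccatiMap (δ : ℝ) (A : Matrix ι ι ℂ) (C : Matrix κ ι ℂ)
    (Q : Matrix ι ι ℂ) {P : Matrix ι ι ℂ} (hP : P.PosSemidef) (K : Matrix ι κ ℂ) :
    mixedLyapunov δ A (A + K * C) P + (1 - δ ^ 2) • (K * Kᴴ) + Q - riccatiMap δ A C Q P =
      (1 - δ ^ 2) • ((K - riccatiGain A C P) * (C * P * Cᴴ + 1) * (K - riccatiGain A C P)ᴴ) := by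
  have hS := hP.innovation_posDef C
  have hdet := (Matrix.isUnit_iff_isUnit_det _).1 hS.isUnit
  have hPh : Pᴴ = P := hP.isHermitian
  set R := (C * P * Cᴴ + 1)⁻¹ with hR
  have hRS : R * (C * P * Cᴴ + 1) = 1 := Matrix.nonsing_inv_mul _ hdet
  have hSR : (C * P * Cᴴ + 1) * R = 1 := Matrix.mul_nonsing_inv _ hdet
  have hRh : Rᴴ = R := hS.inv.isHermitian
  have e : (K - riccatiGain A C P) * (C * P * Cᴴ + 1) * (K - riccatiGain A C P)ᴴ =
      K * (C * P * Cᴴ + 1) * Kᴴ + A * P * Cᴴ * (R * (C * P * Cᴴ + 1)) * Kᴴ +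
        K * ((C * P * Cᴴ + 1) * R) * C * P * Aᴴ +
        A * P * Cᴴ * (R * (C * P * Cᴴ + 1)) * R * C * P * Aᴴ := by
    rw [riccatiGain, ← hR]
    generalize C * P * Cᴴ + 1 = S
    simp only [sub_neg_eq_add, Matrix.conjTranspose_add, Matrix.conjTranspose_mul,
      Matrix.conjTranspose_conjTranspose, hPh, hRh, Matrix.add_mul, Matrix.mul_add,
      Matrix.mul_assoc]
    abel
  rw [e, hRS, hSR, mixedLyapunov, riccatiMap, ← hR]
  simp only [Matrix.conjTranspose_add, Matrix.conjTranspose_mul, Matrix.add_mul, Matrix.mul_add,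
      Matrix.mul_assoc, Matrix.mul_one]
  module

theorem posSemidef_mixedLyapunov_add_sub_riccatiMap {δ : ℝ} (hδ : 0 ≤ 1 - δ ^ 2)
    (A : Matrix ι ι ℂ) (C : Matrix κ ι ℂ) (Q : Matrix ι ι ℂ) {P : Matrix ι ι ℂ}
    (hP : P.PosSemidef) (K : Matrix ι κ ℂ) :
    (mixedLyapunov δ A (A + K * C) P + (1 - δ ^ 2) • (K * Kᴴ) + Q -
      riccatiMap δ A C Q P).PosSemidef := by
  rw [mixedLyapunov_add_sub_riccatiMap δ A C Q hP]
  exact ((hP.innovation_posDef C).posSemidef.mul_mul_conjTranspose_same _).smul hδ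

theorem riccatiMap_eq_mixedLyapunov (δ : ℝ) (A : Matrix ι ι ℂ) (C : Matrix κ ι ℂ)
    (Q : Matrix ι ι ℂ) {P : Matrix ι ι ℂ} (hP : P.PosSemidef) :
    riccatiMap δ A C Q P = mixedLyapunov δ A (A + riccatiGain A C P * C) P +
      (1 - δ ^ 2) • (riccatiGain A C P * (riccatiGain A C P)ᴴ) + Q := by
  have := mixedLyapunov_add_sub_riccatiMap δ A C Q hP (riccatiGain A C P)
  rw [sub_self, Matrix.zero_mul, Matrix.zero_mul, smul_zero, sub_eq_zero] at this
  exact this.symm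

theorem riccatiMap_sub_posSemidef {δ : ℝ} (hδ : 0 ≤ 1 - δ ^ 2) (A : Matrix ι ι ℂ)
    (C : Matrix κ ι ℂ) (Q : Matrix ι ι ℂ) {P : Matrix ι ι ℂ} (hP : P.PosSemidef) :
    (riccatiMap δ A C Q P - Q).PosSemidef := by
  rw [riccatiMap_eq_mixedLyapunov δ A C Q hP, add_sub_cancel_right]
  exact (mixedLyapunov_posSemidef hδ _ _ hP).add
    ((Matrix.posSemidef_self_mul_conjTranspose _).smul hδ)

/-- The gain optimal for `P'` is merely admissible for `P`, and for a fixed gain the cost is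
monotone. -/
theorem riccatiMap_mono {δ : ℝ} (hδ : 0 ≤ 1 - δ ^ 2) (A : Matrix ι ι ℂ)
    (C : Matrix κ ι ℂ) (Q : Matrix ι ι ℂ) {P P' : Matrix ι ι ℂ} (hP : P.PosSemidef)
    (hP' : P'.PosSemidef) (h : (P' - P).PosSemidef) :
    (riccatiMap δ A C Q P' - riccatiMap δ A C Q P).PosSemidef := by
  have h1 := posSemidef_mixedLyapunov_add_sub_riccatiMap hδ A C Q hP (riccatiGain A C P')
  have h2 := mixedLyapunov_posSemidef hδ A (A + riccatiGain A C P' * C) h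
  rw [mixedLyapunov_sub] at h2
  convert h1.add h2 using 1
  rw [riccatiMap_eq_mixedLyapunov δ A C Q hP']
  abel

theorem continuousOn_riccatiMap (δ : ℝ) (A : Matrix ι ι ℂ) (C : Matrix κ ι ℂ)
    (Q : Matrix ι ι ℂ) : ContinuousOn (riccatiMap δ A C Q) {P | P.PosSemidef} := by
  rw [continuousOn_iff_continuous_domRestrict]
  have hid : Continuous fun P : {P : Matrix ι ι ℂ | P.PosSemidef} => (P : Matrix ι ι ℂ) :=
    continuous_subtype_val
  have hS : Continuous fun P : {P : Matrix ι ι ℂ | P.PosSemidef} =>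
      C * (P : Matrix ι ι ℂ) * Cᴴ + 1 :=
    ((continuous_const.matrix_mul hid).matrix_mul continuous_const).add continuous_const
  have hR : Continuous fun P : {P : Matrix ι ι ℂ | P.PosSemidef} =>
      (C * (P : Matrix ι ι ℂ) * Cᴴ + 1)⁻¹ := by
    simp only [Matrix.inv_def, Ring.inverse_eq_inv']
    exact (hS.matrix_det.inv₀ fun P => (Matrix.PosSemidef.innovation_posDef P.2 C).det_pos.ne').smul
      hS.matrix_adjugate
  have hAP := (continuous_const (y := A)).matrix_mul hid
  have hAPA := hAP.matrix_mul (continuous_const (y := Aᴴ))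
  have hgain := (hAP.matrix_mul (continuous_const (y := Cᴴ))).matrix_mul hR
  have hcorr := ((hgain.matrix_mul (continuous_const (y := C))).matrix_mul hid).matrix_mul
    (continuous_const (y := Aᴴ))
  exact (hAPA.sub (hcorr.const_smul (1 - δ ^ 2))).add continuous_const

/-- Sub-solutions of a contracting Lyapunov operator are nonpositive. -/
theorem posSemidef_neg_of_mixedLyapunov {δ : ℝ} (hδ : 0 ≤ 1 - δ ^ 2) {A M X D : Matrix ι ι ℂ}
    (hX : X.PosDef) (hW : (X - mixedLyapunov δ A M X).PosDef) (hD : D.IsHermitian)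
    (h : (mixedLyapunov δ A M D - D).PosSemidef) : (-D).PosSemidef := by
  obtain ⟨c, hc, hcD⟩ := hX.exists_forall_smul_sub hD
  obtain ⟨d₀, hd₀, hdW⟩ := hW.exists_forall_sub_smul hX.isHermitian
  set d := min d₀ (1 / 2) with hd
  have hd0 : 0 < d := lt_min hd₀ (by norm_num)
  have hd1 : d ≤ 1 / 2 := min_le_right _ _
  have hWd := (hdW d hd0 (min_le_left _ _)).posSemidef
  -- Since `W ≥ d X`, the operator maps `X` below `(1 - d) X`; iterating `D ≤ mixedLyapunov δ A M D`
  -- from `D ≤ c X` gives geometric decay. The cap `d ≤ 1 / 2` keeps `1 - d` positive.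
  have hk : ∀ k : ℕ, ((c * (1 - d) ^ k) • X - D).PosSemidef := by
    intro k
    induction k with
    | zero => simpa using (hcD c le_rfl).posSemidef
    | succ k ih =>
      have h1 := mixedLyapunov_posSemidef hδ A M ih
      rw [mixedLyapunov_sub, mixedLyapunov_smul] at h1
      have h2 := hWd.smul (a := c * (1 - d) ^ k)
        (mul_nonneg hc.le (pow_nonneg (by linarith) k))
      convert (h1.add h2).add h using 1
      rw [pow_succ]
      module
  have ht : Filter.Tendsto (fun k : ℕ => (c * (1 - d) ^ k) • X - D) Filter.atTop
      (nhds ((c * 0) • X - D)) :=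
    ((tendsto_const_nhds.mul (tendsto_pow_atTop_nhds_zero_of_lt_one (by linarith)
      (by linarith))).smul_const X).sub_const D
  rw [mul_zero, zero_smul, zero_sub] at ht
  exact Matrix.isClosed_setOf_posSemidef.mem_of_tendsto ht (Filter.Eventually.of_forall hk)

theorem riccati_posDef {δ : ℝ} (hδ : 0 ≤ 1 - δ ^ 2) {A : Matrix ι ι ℂ} {C : Matrix κ ι ℂ}
    {Q P : Matrix ι ι ℂ} (hQ : Q.PosDef) (hP : P.PosSemidef) (h : riccatiMap δ A C Q P = P) :
    P.PosDef := by
  have := hQ.add_posSemidef (riccatiMap_sub_posSemidef hδ A C Q hP)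
  rwa [h, add_sub_cancel] at this

/-- With the gain of `P'` fixed, `P'` is a strict Lyapunov certificate, while suboptimality of that
gain for `P` makes `P - P'` a sub-solution of the same operator. -/
theorem riccati_le {δ : ℝ} (hδ : 0 ≤ 1 - δ ^ 2) {A : Matrix ι ι ℂ} {C : Matrix κ ι ℂ}
    {Q P P' : Matrix ι ι ℂ} (hQ : Q.PosDef) (hP : P.PosSemidef) (h : riccatiMap δ A C Q P = P)
    (hP' : P'.PosSemidef) (h' : riccatiMap δ A C Q P' = P') : (P' - P).PosSemidef := by
  have e := riccatiMap_eq_mixedLyapunov δ A C Q hP'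
  rw [h'] at e
  have hLL : ((1 - δ ^ 2) • (riccatiGain A C P' * (riccatiGain A C P')ᴴ)).PosSemidef :=
    (Matrix.posSemidef_self_mul_conjTranspose _).smul hδ
  have h1 := posSemidef_mixedLyapunov_add_sub_riccatiMap hδ A C Q hP (riccatiGain A C P')
  rw [h] at h1
  have e' : P' - mixedLyapunov δ A (A + riccatiGain A C P' * C) P' =
      (1 - δ ^ 2) • (riccatiGain A C P' * (riccatiGain A C P')ᴴ) + Q := by
    rw [sub_eq_iff_eq_add']
    exact e.trans (add_assoc _ _ _)
  have h2 := posSemidef_neg_of_mixedLyapunov hδ (A := A) (M := A + riccatiGain A C P' * C)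
    (D := P - P') (riccati_posDef hδ hQ hP' h') (e' ▸ Matrix.PosDef.posSemidef_add hLL hQ)
    (hP.isHermitian.sub hP'.isHermitian) (by
      convert h1 using 1
      rw [mixedLyapunov_sub, add_assoc _ _ Q, ← e']
      abel)
  simpa using h2

theorem riccati_unique {δ : ℝ} (hδ : 0 ≤ 1 - δ ^ 2) {A : Matrix ι ι ℂ} {C : Matrix κ ι ℂ}
    {Q P P' : Matrix ι ι ℂ} (hQ : Q.PosDef) (hP : P.PosSemidef) (h : riccatiMap δ A C Q P = P)
    (hP' : P'.PosSemidef) (h' : riccatiMap δ A C Q P' = P') : P' = P := by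
  open scoped MatrixOrder in
  exact le_antisymm (Matrix.le_iff.2 (riccati_le hδ hQ hP' h' hP h))
    (Matrix.le_iff.2 (riccati_le hδ hQ hP h hP' h'))

/-- For large `c` the contraction surplus of `c • X` absorbs `(1 - δ²) K Kᴴ + Q`, making `c • X` a
supersolution. -/
theorem HasContractingGain.exists_riccati {δ : ℝ} (hδ : 0 ≤ 1 - δ ^ 2) {A : Matrix ι ι ℂ}
    {C : Matrix κ ι ℂ} (h : HasContractingGain δ A C) {Q : Matrix ι ι ℂ} (hQ : Q.PosDef) :
    ∃ P, P.PosSemidef ∧ riccatiMap δ A C Q P = P := by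
  obtain ⟨K, X, hX, hW⟩ := h
  have hKK : ((1 - δ ^ 2) • (K * Kᴴ)).PosSemidef :=
    (Matrix.posSemidef_self_mul_conjTranspose K).smul hδ
  obtain ⟨c, hc, hcW⟩ := hW.exists_forall_smul_sub (hKK.add hQ.posSemidef).isHermitian
  have hcX : (c • X).PosSemidef := hX.posSemidef.smul hc.le
  refine Matrix.PosSemidef.exists_fixedPoint (fun P hP => ?_)
    (fun P P' hP hP' h => riccatiMap_mono hδ A C Q hP hP' h)
    (continuousOn_riccatiMap δ A C Q) hcX ?_
  · simpa using (riccatiMap_sub_posSemidef hδ A C Q hP).add hQ.posSemidef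
  · have h1 := posSemidef_mixedLyapunov_add_sub_riccatiMap hδ A C Q hcX K
    convert (hcW c le_rfl).posSemidef.add h1 using 1
    rw [mixedLyapunov_smul, smul_sub]
    abel

/-- Testing on a left eigenvector gives `(1 - |μ|²) v* P v > 0`, so semidefiniteness of `P`
suffices. -/
theorem Matrix.norm_lt_one_of_sub_conj_posDef {M P : Matrix ι ι ℂ} (hP : P.PosSemidef)
    (h : (P - M * P * Mᴴ).PosDef) {μ : ℂ} (hμ : μ ∈ spectrum ℂ M) : ‖μ‖ < 1 := by
  have hμ' : star μ ∈ spectrum ℂ Mᴴ := by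
    rw [← Matrix.star_eq_conjTranspose, spectrum.map_star, Set.mem_star, star_star]
    exact hμ
  obtain ⟨v, hv, hMv⟩ := Matrix.mem_spectrum_iff_exists_mulVec.1 hμ'
  have h1 := h.re_dotProduct_pos hv
  have h2 := hP.re_dotProduct_nonneg v
  have hvM : star v ᵥ* M = μ • star v := by
    have := congrArg star hMv
    rwa [Matrix.star_mulVec, Matrix.conjTranspose_conjTranspose, star_smul, star_star] at this
  have e : star v ⬝ᵥ (M * P * Mᴴ) *ᵥ v = (‖μ‖ ^ 2 : ℝ) * (star v ⬝ᵥ P *ᵥ v) := by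
    rw [← Matrix.mulVec_mulVec, ← Matrix.mulVec_mulVec, hMv, Matrix.dotProduct_mulVec, hvM,
      Matrix.mulVec_smul, dotProduct_smul, smul_dotProduct, smul_smul, smul_eq_mul,
      Complex.star_def, Complex.conj_mul']
    push_cast
    rfl
  rw [Matrix.sub_mulVec, dotProduct_sub, e] at h1
  simp only [RCLike.re_to_complex, Complex.sub_re, Complex.re_ofReal_mul] at h1 h2
  by_contra h3
  push Not at h3
  nlinarith [one_le_pow₀ h3 (n := 2)]

theorem closedLoop_stable {δ : ℝ} {A : Matrix ι ι ℂ} {C : Matrix κ ι ℂ} {Q P : Matrix ι ι ℂ}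
    (hQ : Q.PosDef) (hP : P.PosSemidef) (h : riccatiMap δ A C Q P = P) {σ : ℂ} (hσ : ‖σ‖ ≤ δ)
    {μ : ℂ} (hμ : μ ∈ spectrum ℂ (A + (1 - σ) • (riccatiGain A C P * C))) : ‖μ‖ < 1 := by
  refine Matrix.norm_lt_one_of_sub_conj_posDef hP ?_ hμ
  have hS := hP.innovation_posDef C
  have hdet := (Matrix.isUnit_iff_isUnit_det _).1 hS.isUnit
  have hPh : Pᴴ = P := hP.isHermitian
  set R := (C * P * Cᴴ + 1)⁻¹ with hR
  have hRS : R * (C * P * Cᴴ + 1) = 1 := Matrix.nonsing_inv_mul _ hdet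
  have hRh : Rᴴ = R := hS.inv.isHermitian
  have hRSR : R * (C * P * Cᴴ) * R = R - R * R := by
    rw [eq_sub_iff_add_eq]
    calc R * (C * P * Cᴴ) * R + R * R = R * (C * P * Cᴴ + 1) * R := by
          rw [Matrix.mul_add, Matrix.add_mul, Matrix.mul_one]
      _ = R := by rw [hRS, Matrix.one_mul]
  set J := A * P * Cᴴ with hJ
  have hJh : Jᴴ = C * P * Aᴴ := by
    simp only [hJ, Matrix.conjTranspose_mul, Matrix.conjTranspose_conjTranspose, hPh,
      Matrix.mul_assoc]
  have hL : riccatiGain A C P = -(J * R) := rfl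
  have hMPM : (A + (1 - σ) • (riccatiGain A C P * C)) * P *
      (A + (1 - σ) • (riccatiGain A C P * C))ᴴ =
      A * P * Aᴴ - ((1 - σ) + star (1 - σ)) • (J * R * Jᴴ) +
        ((1 - σ) * star (1 - σ)) • (J * (R * (C * P * Cᴴ) * R) * Jᴴ) := by
    rw [hL, hJh]
    simp only [hJ, Matrix.conjTranspose_add, Matrix.conjTranspose_smul, Matrix.conjTranspose_mul,
      Matrix.conjTranspose_neg, Matrix.conjTranspose_conjTranspose, hRh, hPh, Matrix.add_mul,
      Matrix.mul_add, Matrix.neg_mul, Matrix.mul_neg, Matrix.smul_mul, Matrix.mul_smul,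
      Matrix.mul_assoc]
    module
  have hfix : P = A * P * Aᴴ - (1 - δ ^ 2) • (J * R * Jᴴ) + Q := by
    conv_lhs => rw [← h, riccatiMap]
    rw [hJh, ← hR, ← hJ]
    simp only [Matrix.mul_assoc]
  -- One `P` certifies the whole disc: by `2 Re (1 - σ) = 1 + |1 - σ|² - |σ|²`, the `R` terms
  -- collect to `δ² - |σ|² ≥ 0`.
  have e : P - (A + (1 - σ) • (riccatiGain A C P * C)) * P *
      (A + (1 - σ) • (riccatiGain A C P * C))ᴴ =
      Q + J * ((δ ^ 2 - ‖σ‖ ^ 2) • R + (‖1 - σ‖ ^ 2) • (R * Rᴴ)) * Jᴴ := by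
    have hσσ : σ * star σ = ((‖σ‖ ^ 2 : ℝ) : ℂ) := by
      rw [Complex.star_def, Complex.mul_conj']; push_cast; rfl
    have hσ1 : (1 - σ) * star (1 - σ) = ((‖1 - σ‖ ^ 2 : ℝ) : ℂ) := by
      rw [Complex.star_def, Complex.mul_conj']; push_cast; rfl
    have hsum : (1 - σ) + star (1 - σ) = ((1 + ‖1 - σ‖ ^ 2 - ‖σ‖ ^ 2 : ℝ) : ℂ) := by
      rw [Complex.ofReal_sub, Complex.ofReal_add, ← hσ1, ← hσσ, star_sub, star_one,
        Complex.ofReal_one]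
      ring
    rw [hMPM, hRSR, hsum, hσ1, Complex.coe_smul, Complex.coe_smul, hRh]
    rw [sub_eq_iff_eq_add]
    refine hfix.trans ?_
    simp only [Matrix.mul_sub, Matrix.sub_mul, Matrix.mul_add, Matrix.add_mul, Matrix.smul_mul,
      Matrix.mul_smul]
    module
  rw [e]
  refine hQ.add_posSemidef (Matrix.PosSemidef.mul_mul_conjTranspose_same ?_ J)
  have h1 : 0 ≤ δ ^ 2 - ‖σ‖ ^ 2 := by nlinarith [norm_nonneg σ]
  exact (hS.inv.posSemidef.smul h1).add
    ((Matrix.posSemidef_self_mul_conjTranspose R).smul (sq_nonneg _))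

/-- Symmetry of the Riccati equation under transposition when the data are real. -/
theorem riccatiMap_transpose (δ : ℝ) {A : Matrix ι ι ℂ} {C : Matrix κ ι ℂ} {Q : Matrix ι ι ℂ}
    (hA : Aᴴ = Aᵀ) (hC : Cᴴ = Cᵀ) (hQ : Qᵀ = Q) (P : Matrix ι ι ℂ) :
    riccatiMap δ A C Q Pᵀ = (riccatiMap δ A C Q P)ᵀ := by
  simp only [riccatiMap, hA, hC, Matrix.transpose_add, Matrix.transpose_sub, Matrix.transpose_smul,
    Matrix.transpose_mul, Matrix.transpose_nonsing_inv, Matrix.transpose_transpose,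
    Matrix.transpose_one, hQ, Matrix.mul_assoc]

end ModifiedRiccati

/-! ### Passage between real and complex matrices. -/

section RealTransfer

open scoped Matrix ComplexOrder

variable {m n p q : ℕ}

theorem toComplex_mul (M : Matrix (Fin m) (Fin n) ℝ) (N : Matrix (Fin n) (Fin p) ℝ) :
    toComplex (M * N) = toComplex M * toComplex N :=
  Matrix.map_mul (f := Complex.ofRealHom)

theorem toComplex_add (M N : Matrix (Fin m) (Fin n) ℝ) :
    toComplex (M + N) = toComplex M + toComplex N := by
  ext i j; simp [toComplex]

theorem toComplex_sub (M N : Matrix (Fin m) (Fin n) ℝ) :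
    toComplex (M - N) = toComplex M - toComplex N := by
  ext i j; simp [toComplex]

theorem toComplex_neg (M : Matrix (Fin m) (Fin n) ℝ) : toComplex (-M) = -toComplex M := by
  ext i j; simp [toComplex]

theorem toComplex_smul (c : ℝ) (M : Matrix (Fin m) (Fin n) ℝ) :
    toComplex (c • M) = c • toComplex M := by
  ext i j; simp [toComplex]

theorem toComplex_one : toComplex (1 : Matrix (Fin n) (Fin n) ℝ) = 1 :=
  Matrix.map_one _ Complex.ofReal_zero Complex.ofReal_one

theorem toComplex_transpose (M : Matrix (Fin m) (Fin n) ℝ) : toComplex Mᵀ = (toComplex M)ᵀ := rfl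

theorem toComplex_conjTranspose (M : Matrix (Fin m) (Fin n) ℝ) :
    (toComplex M)ᴴ = (toComplex M)ᵀ := by
  ext i j; simp [toComplex]

theorem toComplex_injective :
    Function.Injective (toComplex : Matrix (Fin m) (Fin n) ℝ → Matrix (Fin m) (Fin n) ℂ) :=
  Matrix.map_injective Complex.ofReal_injective

theorem toComplex_inv (M : Matrix (Fin n) (Fin n) ℝ) : toComplex M⁻¹ = (toComplex M)⁻¹ := by
  by_cases h : IsUnit M.det
  · refine (Matrix.inv_eq_right_inv ?_).symm
    rw [← toComplex_mul, Matrix.mul_nonsing_inv _ h, toComplex_one]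
  -- For singular `M` both inverses take the default value zero.
  · have h' : ¬ IsUnit (toComplex M).det := by
      have : (toComplex M).det = (M.det : ℂ) := (RingHom.map_det Complex.ofRealHom M).symm
      rw [this, isUnit_iff_ne_zero, Complex.ofReal_ne_zero, ← isUnit_iff_ne_zero]
      exact h
    rw [Matrix.nonsing_inv_apply_not_isUnit _ h, Matrix.nonsing_inv_apply_not_isUnit _ h']
    ext i j; simp [toComplex]

theorem toComplex_posSemidef_iff {M : Matrix (Fin n) (Fin n) ℝ} :
    (toComplex M).PosSemidef ↔ M.PosSemidef := by
  constructor
  · intro h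
    refine .of_dotProduct_mulVec_nonneg ?_ fun x => ?_
    · have := h.1
      rw [Matrix.IsHermitian, toComplex_conjTranspose, ← toComplex_transpose] at this
      exact toComplex_injective this
    · have := h.dotProduct_mulVec_nonneg (fun i => (x i : ℂ))
      have e : star (fun i => (x i : ℂ)) ⬝ᵥ toComplex M *ᵥ (fun i => (x i : ℂ)) =
          ((star x ⬝ᵥ M *ᵥ x : ℝ) : ℂ) := by
        simp [dotProduct, Matrix.mulVec, toComplex]
      rw [e] at this
      exact_mod_cast this
  · intro h
    open scoped MatrixOrder in
    -- A factorization `Bᵀ B` survives complexification, so complex vectors need not be split into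
    -- real and imaginary parts.
    obtain ⟨B, rfl⟩ := CStarAlgebra.nonneg_iff_eq_star_mul_self.1 (Matrix.nonneg_iff_posSemidef.2 h)
    rw [Matrix.star_eq_conjTranspose, Matrix.conjTranspose_eq_transpose_of_trivial, toComplex_mul,
      toComplex_transpose, ← toComplex_conjTranspose]
    exact Matrix.posSemidef_conjTranspose_mul_self _

theorem toComplex_posDef_iff {M : Matrix (Fin n) (Fin n) ℝ} :
    (toComplex M).PosDef ↔ M.PosDef := by
  have hdet : (toComplex M).det = (M.det : ℂ) := (RingHom.map_det Complex.ofRealHom M).symm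
  constructor
  · intro h
    have h1 := toComplex_posSemidef_iff.1 h.posSemidef
    rw [h1.posDef_iff_det_ne_zero]
    have := h.det_pos.ne'
    rwa [hdet, Complex.ofReal_ne_zero] at this
  · intro h
    have h1 := toComplex_posSemidef_iff.2 h.posSemidef
    rw [h1.posDef_iff_det_ne_zero, hdet, Complex.ofReal_ne_zero]
    exact h.det_pos.ne'

theorem satisfiesMARE_iff {A : Matrix (Fin n) (Fin n) ℝ} {C : Matrix (Fin q) (Fin n) ℝ}
    {Q P : Matrix (Fin n) (Fin n) ℝ} {δ : ℝ} :
    SatisfiesMARE A C Q δ P ↔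
      riccatiMap δ (toComplex A) (toComplex C) (toComplex Q) (toComplex P) = toComplex P := by
  rw [SatisfiesMARE, ← toComplex_injective.eq_iff, eq_comm]
  simp only [riccatiMap, toComplex_add, toComplex_sub, toComplex_smul, toComplex_mul,
    toComplex_inv, toComplex_one, toComplex_conjTranspose, toComplex_transpose]

theorem toComplex_observerGain (A : Matrix (Fin n) (Fin n) ℝ) (C : Matrix (Fin q) (Fin n) ℝ)
    (P : Matrix (Fin n) (Fin n) ℝ) :
    toComplex (observerGain A C P) = riccatiGain (toComplex A) (toComplex C) (toComplex P) := by
  simp only [observerGain, riccatiGain, toComplex_neg, toComplex_mul, toComplex_inv,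
    toComplex_add, toComplex_one, toComplex_conjTranspose, toComplex_transpose]

theorem exists_toComplex_eq {P : Matrix (Fin n) (Fin n) ℂ} (hP : Pᴴ = Pᵀ) :
    ∃ P' : Matrix (Fin n) (Fin n) ℝ, toComplex P' = P := by
  refine ⟨P.map Complex.re, ?_⟩
  ext i j
  exact Complex.conj_eq_iff_re.1 (congrFun (congrFun hP j) i)

theorem isEigenvalue_iff_mem_spectrum {M : Matrix (Fin n) (Fin n) ℂ} {μ : ℂ} :
    IsEigenvalue M μ ↔ μ ∈ spectrum ℂ M := by
  rw [IsEigenvalue, Module.End.hasEigenvalue_iff_mem_spectrum, Matrix.spectrum_toLin']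

/-- Output injection does not change `A` on the kernel of `C`. -/
theorem IsDetectable.unobservableModesStable {A : Matrix (Fin n) (Fin n) ℝ}
    {C : Matrix (Fin q) (Fin n) ℝ} (h : IsDetectable A C) :
    UnobservableModesStable (toComplex A) (toComplex C) := by
  obtain ⟨G, hG⟩ := h
  intro μ v hv hAv hCv
  refine hG μ (isEigenvalue_iff_mem_spectrum.2
    (Matrix.mem_spectrum_iff_exists_mulVec.2 ⟨v, hv, ?_⟩))
  rw [toComplex_add, toComplex_mul, Matrix.add_mulVec, ← Matrix.mulVec_mulVec, hCv,
    Matrix.mulVec_zero, add_zero, hAv]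

/-- The modified algebraic Riccati equation is uniquely solvable, with stable closed loops,
whenever `δ` times the product of the unstable eigenvalues is less than one. -/
theorem IsDetectable.existsUnique_satisfiesMARE {A : Matrix (Fin n) (Fin n) ℝ}
    {C : Matrix (Fin q) (Fin n) ℝ} (hAC : IsDetectable A C) {Q : Matrix (Fin n) (Fin n) ℝ}
    (hQ : Q.PosDef) {δ : ℝ} (hδ : 0 < δ) (hδA : δ * unstableEigenvalueProduct A < 1) :
    ∃ P : Matrix (Fin n) (Fin n) ℝ,
      P.PosDef ∧ SatisfiesMARE A C Q δ P ∧
      (∀ P' : Matrix (Fin n) (Fin n) ℝ, P'.PosSemidef → SatisfiesMARE A C Q δ P' → P' = P) ∧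
      ∀ σ : ℂ, ‖σ‖ ≤ δ → IsSchurStable (closedLoop A C (observerGain A C P) σ) := by
  have hδ1 : 0 ≤ 1 - δ ^ 2 := by
    have h1 : 1 ≤ unstableEigenvalueProduct A := one_le_unstableProduct (toComplex A)
    nlinarith
  have hQc := toComplex_posDef_iff.2 hQ
  obtain ⟨Z, hZ, hfix⟩ :=
    (hAC.unobservableModesStable.hasContractingGain hδ hδA).exists_riccati hδ1 hQc
  -- The transpose solves the same equation, so uniqueness makes `Z` symmetric; being Hermitian as
  -- well, it is real.
  have hZt : Zᵀ = Z := riccati_unique hδ1 hQc hZ hfix hZ.transpose (by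
    have hQt : (toComplex Q)ᵀ = toComplex Q := by
      rw [← toComplex_conjTranspose]; exact hQc.isHermitian
    rw [riccatiMap_transpose δ (toComplex_conjTranspose A) (toComplex_conjTranspose C) hQt, hfix])
  obtain ⟨P, rfl⟩ := exists_toComplex_eq (hZ.isHermitian.eq.trans hZt.symm)
  refine ⟨P, toComplex_posDef_iff.1 (riccati_posDef hδ1 hQc hZ hfix), satisfiesMARE_iff.2 hfix,
    fun P' hP' h' => toComplex_injective (riccati_unique hδ1 hQc hZ hfix
      (toComplex_posSemidef_iff.2 hP') (satisfiesMARE_iff.1 h')), fun σ hσ μ hμ => ?_⟩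
  rw [isEigenvalue_iff_mem_spectrum, closedLoop, toComplex_observerGain] at hμ
  exact closedLoop_stable hQc hZ hfix hσ hμ

end RealTransfer

theorem proposition3 (n q : ℕ) (A : Matrix (Fin n) (Fin n) ℝ) (C : Matrix (Fin q) (Fin n) ℝ)
    (hAC : IsDetectable A C) (Q : Matrix (Fin n) (Fin n) ℝ) (hQ : Q.PosDef)
    (δ : ℝ) (hδ : 0 < δ) :
    ((∀ μ : ℂ, IsEigenvalue (toComplex A) μ → ‖μ‖ ≤ 1) → δ < 1 →
      ∃ P : Matrix (Fin n) (Fin n) ℝ,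
        P.PosDef ∧ SatisfiesMARE A C Q δ P ∧
        (∀ P' : Matrix (Fin n) (Fin n) ℝ,
          P'.PosSemidef → SatisfiesMARE A C Q δ P' → P' = P) ∧
        ∀ σ : ℂ, ‖σ‖ ≤ δ → IsSchurStable (closedLoop A C (observerGain A C P) σ)) ∧
    ((∃ μ : ℂ, IsEigenvalue (toComplex A) μ ∧ 1 < ‖μ‖) →
      δ < 1 / unstableEigenvalueProduct A →
      ∃ P : Matrix (Fin n) (Fin n) ℝ,
        P.PosDef ∧ SatisfiesMARE A C Q δ P ∧
        (∀ P' : Matrix (Fin n) (Fin n) ℝ,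
          P'.PosSemidef → SatisfiesMARE A C Q δ P' → P' = P) ∧
        ∀ σ : ℂ, ‖σ‖ ≤ δ → IsSchurStable (closedLoop A C (observerGain A C P) σ)) := by
  -- Both cases say that `δ` times the unstable product is less than one; in the first the product
  -- is empty.
  refine ⟨fun hA hδ1 => ?_, fun _ hδA => ?_⟩
  · refine hAC.existsUnique_satisfiesMARE hQ hδ ?_
    have h1 : unstableEigenvalueProduct A = 1 :=
      unstableProduct_eq_one fun μ hμ => hA μ (isEigenvalue_iff_mem_spectrum.2 hμ)
    rwa [h1, mul_one]
  · refine hAC.existsUnique_satisfiesMARE hQ hδ ?_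
    have h1 : 1 ≤ unstableEigenvalueProduct A := one_le_unstableProduct (toComplex A)
    rwa [lt_div_iff₀ (by linarith)] at hδA
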